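/- Let $\mathcal H$ be an arbitrary complex Hilbert space, let $\mathcal B^1(\mathcal H)$ be the space of trace class operators on $\mathcal H$, and let $\otimes$ denote the Hilbert space tensor product (and the corresponding tensor product of bounded operators). Let $\Phi:\mathcal B^1(\mathcal H)\to\mathcal B^1(\mathcal H)$ be linear, trace-preserving and completely positive (that is, for all $n\in\mathbb N$ the map $\Phi\otimes\mathrm{id}_n$ on $\mathcal B^1(\mathcal H\otimes\mathbb C^n)$ sends positive semi-definite operators to positive semi-definite operators). For a Hilbert space $\mathcal K$ and a trace class operator $A$ on $\mathcal H\otimes\mathcal K$, let $\operatorname{tr}_{\mathcal K}(A)$ be the partial trace, i.e. the unique trace class operator on $\mathcal H$ with $\operatorname{tr}(\operatorname{tr}_{\mathcal K}(A)B)=\operatorname{tr}(A(B\otimes\mathbf 1))$ for all bounded operators $B$ on $\mathcal H$. Then there exist a complex Hilbert space $\mathcal K$, a unit vector $\psi\in\mathcal K$ and a unitary operator $U$ on $\mathcal H\otimes\mathcal K$ such that $$\Phi(\rho)=\operatorname{tr}_{\mathcal K}\big(U(\rho\otimes|\psi\rangle\langle\psi|)U^*\big)\qquad\text{for all }\rho\in\mathcal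 B^1(\mathcal H).\tag{$*$}$$ Moreover: (i) Let $(K_j)_{j\in J}$ be any family of Kraus operators of $\Phi$, i.e. bounded operators on $\mathcal H$ such that $\Phi(\rho)=\sum_{j\in J}K_j\rho K_j^*$ in trace norm for every $\rho\in\mathcal B^1(\mathcal H)$ and $\sum_{j\in J}K_j^*K_j$ converges strongly to a bounded operator. Then for every $j_0\in J$ there is a unitary $U$ such that $(*)$ holds with $\mathcal K=\ell^2(J)\otimes\mathbb C^2$ and $\psi=e_{j_0}\otimes e_1$. In particular, if $\mathcal H$ is separable, then $\mathcal K$ can be chosen separable: in this case $\Phi$ has a family of Kraus operators for which $\ell^2(J)\otimes\mathbb C^2$ is separable and $J\neq\emptyset$. (ii) The unitary $U$ in (i) can moreover be chosen such that the auxiliary qubit $\mathbb C^2$ is a catalyst: for every state $\rho$ on $\mathcal H$ (positive semi-definite trace class operator of trace one) there exists a state $\omega$ on $\mathcal H\otimes\ell^2(J)$ such that $$U\big(\rho\otimes|e_{j_0}\rangle\langle e_{j_0}|\otimes|e_1\rangle\langle e_1|\big)U^*=\omega\otimes|e_1\rangle\langle e_1|,$$ where $\mathcal H\otimes(\ell^2(J)\otimes\mathbb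 C^2)$ and $(\mathcal H\otimes\ell^2(J))\otimes\mathbb C^2$ are identified in the canonical way. -/

import Mathlib

open scoped TensorProduct
open InnerProductSpace (rankOne)

universe u v w

noncomputable section

/-! ### Hilbert space tensor products -/

section Tensor

variable (H : Type u) [NormedAddCommGroup H] [InnerProductSpace ℂ H]
variable (K : Type v) [NormedAddCommGroup K] [InnerProductSpace ℂ K]
variable (L : Type w) [NormedAddCommGroup L] [InnerProductSpace ℂ L]

/-- The Hilbert space tensor product: the completion of the algebraic tensor product with respect
to the inner product determined by `⟪x ⊗ y, x' ⊗ y'⟫ = ⟪x, x'⟫ ⟪y, y'⟫`. -/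
abbrev HTensor : Type (max u v) := UniformSpace.Completion (H ⊗[ℂ] K)

variable {H K L}

/-- The elementary tensor `x ⊗ y` in the Hilbert space tensor product. -/
def htmul (x : H) (y : K) : HTensor H K := ((x ⊗ₜ[ℂ] y : H ⊗[ℂ] K) : HTensor H K)

/-- The tensor product `A ⊗ B` of two bounded operators, as a bounded operator on the Hilbert space
tensor product. -/
def opTensor (A : H →L[ℂ] H) (B : K →L[ℂ] K) : HTensor H K →L[ℂ] HTensor H K :=
  (TensorProduct.mapL A B).completion

theorem opTensor_htmul (A : H →L[ℂ] H) (B : K →L[ℂ] K) (x : H) (y : K) :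
    opTensor A B (htmul x y) = htmul (A x) (B y) := by
  simp [opTensor, htmul]

variable (H K L)

/-- The isometric embedding of the algebraic tensor product `(H ⊗ K) ⊗ L` into the
Hilbert space tensor product `(H ⊗ K) ⊗ L`. -/
def embLeft : (H ⊗[ℂ] K) ⊗[ℂ] L →ₗᵢ[ℂ] HTensor (HTensor H K) L :=
  UniformSpace.Completion.toComplₗᵢ.comp
    (LinearIsometry.rTensor L (UniformSpace.Completion.toComplₗᵢ (𝕜 := ℂ) (E := H ⊗[ℂ] K)))

/-- The isometric embedding of the algebraic tensor product `H ⊗ (K ⊗ L)` into the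
Hilbert space tensor product `H ⊗ (K ⊗ L)`. -/
def embRight : H ⊗[ℂ] (K ⊗[ℂ] L) →ₗᵢ[ℂ] HTensor H (HTensor K L) :=
  UniformSpace.Completion.toComplₗᵢ.comp
    (LinearIsometry.lTensor H (UniformSpace.Completion.toComplₗᵢ (𝕜 := ℂ) (E := K ⊗[ℂ] L)))

variable {H K L}

/-- A linear map whose range contains the elementary tensors in its closure has dense range. -/
theorem denseRange_of_htmul {E : Type*} [AddCommGroup E] [Module ℂ E]
    (f : E →ₗ[ℂ] HTensor H K)
    (hf : ∀ (x : H) (y : K), htmul x y ∈ closure (Set.range f)) : DenseRange f := by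
  have hcl : closure (Set.range f) = ((LinearMap.range f).topologicalClosure : Set (HTensor H K)) := by
    rw [Submodule.topologicalClosure_coe, LinearMap.coe_range]
  intro z
  induction z using UniformSpace.Completion.induction_on with
  | hp => exact isClosed_closure
  | ih t =>
    rw [hcl]
    induction t using TensorProduct.induction_on with
    | zero =>
      rw [UniformSpace.Completion.coe_zero]
      exact zero_mem _
    | tmul x y =>
      have := hf x y
      rw [hcl] at this
      exact this
    | add a b ha hb =>
      rw [UniformSpace.Completion.coe_add]
      exact add_mem ha hb

theorem denseRange_embLeft : DenseRange (embLeft H K L).toLinearMap := by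
  refine denseRange_of_htmul _ fun z y => ?_
  have hc : Continuous fun z : HTensor H K => (htmul z y : HTensor (HTensor H K) L) :=
    (UniformSpace.Completion.continuous_coe _).comp
      (TensorProduct.continuous_tmul.comp (continuous_id.prodMk continuous_const))
  induction z using UniformSpace.Completion.induction_on with
  | hp => exact isClosed_closure.preimage hc
  | ih t => exact subset_closure ⟨t ⊗ₜ y, rfl⟩

theorem denseRange_embRight : DenseRange (embRight H K L).toLinearMap := by
  refine denseRange_of_htmul _ fun x z => ?_
  have hc : Continuous fun z : HTensor K L => (htmul x z : HTensor H (HTensor K L)) :=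
    (UniformSpace.Completion.continuous_coe _).comp
      (TensorProduct.continuous_tmul.comp (continuous_const.prodMk continuous_id))
  induction z using UniformSpace.Completion.induction_on with
  | hp => exact isClosed_closure.preimage hc
  | ih t => exact subset_closure ⟨x ⊗ₜ t, rfl⟩

variable (H K L)

/-- The canonical unitary identification `(H ⊗ K) ⊗ L ≃ H ⊗ (K ⊗ L)` of Hilbert space tensor
products. -/
def hassoc : HTensor (HTensor H K) L ≃ₗᵢ[ℂ] HTensor H (HTensor K L) :=
  (TensorProduct.assoc ℂ H K L).extendOfIsometry (embLeft H K L).toLinearMap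
    (embRight H K L).toLinearMap denseRange_embLeft denseRange_embRight (by
      intro x
      change ‖embRight H K L (TensorProduct.assoc ℂ H K L x)‖ = ‖embLeft H K L x‖
      rw [LinearIsometry.norm_map, LinearIsometry.norm_map, TensorProduct.norm_assoc])

theorem hassoc_htmul (x : H) (y : K) (z : L) :
    hassoc H K L (htmul (htmul x y) z) = htmul x (htmul y z) :=
  LinearEquiv.extendOfIsometry_eq (f := TensorProduct.assoc ℂ H K L)
    (e₁ := (embLeft H K L).toLinearMap) (e₂ := (embRight H K L).toLinearMap)
    denseRange_embLeft denseRange_embRight _ ((x ⊗ₜ y) ⊗ₜ z)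

end Tensor

/-! ### Trace class operators, the trace and the trace norm -/

section TraceClass

variable {H : Type u} [NormedAddCommGroup H] [InnerProductSpace ℂ H]

/-- `T = ∑ₙ |xₙ⟩⟨yₙ|` with `∑ₙ ‖xₙ‖ ‖yₙ‖ = r`. -/
def IsNuclearRep (T : H →L[ℂ] H) (x y : ℕ → H) (r : ℝ) : Prop :=
  HasSum (fun n => ‖x n‖ * ‖y n‖) r ∧ HasSum (fun n => rankOne ℂ (x n) (y n)) T

/-- Trace class (equivalently, on a Hilbert space, nuclear) operators. -/
def IsTraceClass (T : H →L[ℂ] H) : Prop :=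
  ∃ (x y : ℕ → H) (r : ℝ), IsNuclearRep T x y r

/-- The trace norm (equivalently, on a Hilbert space, the nuclear norm) of a trace class
operator. -/
def traceNorm (T : H →L[ℂ] H) : ℝ :=
  sInf {r : ℝ | ∃ x y : ℕ → H, IsNuclearRep T x y r}

theorem IsTraceClass.zero : IsTraceClass (0 : H →L[ℂ] H) :=
  ⟨0, 0, 0, by simp [IsNuclearRep, hasSum_zero]⟩

theorem IsTraceClass.add {S T : H →L[ℂ] H} (hS : IsTraceClass S) (hT : IsTraceClass T) :
    IsTraceClass (S + T) := by
  obtain ⟨x, y, r, h1, h2⟩ := hS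
  obtain ⟨x', y', r', h1', h2'⟩ := hT
  let e : ℕ ≃ ℕ ⊕ ℕ := (Denumerable.eqv (ℕ ⊕ ℕ)).symm
  refine ⟨Sum.elim x x' ∘ e, Sum.elim y y' ∘ e, r + r', ?_, ?_⟩
  · exact (e.hasSum_iff (f := fun s => ‖Sum.elim x x' s‖ * ‖Sum.elim y y' s‖)).2
      (HasSum.sum (f := fun s => ‖Sum.elim x x' s‖ * ‖Sum.elim y y' s‖) h1 h1')
  · exact (e.hasSum_iff (f := fun s => rankOne ℂ (Sum.elim x x' s) (Sum.elim y y' s))).2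
      (HasSum.sum (f := fun s => rankOne ℂ (Sum.elim x x' s) (Sum.elim y y' s)) h2 h2')

theorem IsTraceClass.smul (c : ℂ) {T : H →L[ℂ] H} (hT : IsTraceClass T) :
    IsTraceClass (c • T) := by
  obtain ⟨x, y, r, h1, h2⟩ := hT
  refine ⟨fun n => c • x n, y, ‖c‖ * r, ?_, ?_⟩
  · simpa [norm_smul, mul_assoc] using h1.mul_left ‖c‖
  · simpa using h2.const_smul c

variable (H) in
/-- The space of trace class operators on `H`. -/
def traceClass : Submodule ℂ (H →L[ℂ] H) where
  carrier := {T | IsTraceClass T}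
  zero_mem' := IsTraceClass.zero
  add_mem' := IsTraceClass.add
  smul_mem' c _ := IsTraceClass.smul c

variable [CompleteSpace H]

variable (H) in
/-- The index set of a (chosen) orthonormal basis of `H`. -/
def onbIndex : Set H := (exists_hilbertBasis ℂ H).choose

variable (H) in
/-- A (chosen) orthonormal basis of `H`. -/
def onb : HilbertBasis (onbIndex H) ℂ H := (exists_hilbertBasis ℂ H).choose_spec.choose

/-- The trace `∑ᵢ ⟪eᵢ, T eᵢ⟫`. For trace class `T` the series converges absolutely and its sum does
not depend on the orthonormal basis. -/
def opTrace (T : H →L[ℂ] H) : ℂ := ∑' i, inner ℂ (onb H i) (T (onb H i))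

theorem opTrace_comp_rankOne (T : H →L[ℂ] H) (x y : H) :
    opTrace (T ∘L rankOne ℂ x y) = inner ℂ y (T x) := by
  rw [← (onb H).tsum_inner_mul_inner y (T x)]
  simp [opTrace]

/-- A state (density operator): a positive semi-definite trace class operator of trace one. -/
def IsState (ω : H →L[ℂ] H) : Prop :=
  IsTraceClass ω ∧ ω.IsPositive ∧ opTrace ω = 1

end TraceClass

/-! ### The partial trace -/

section PartialTrace

variable {H : Type u} [NormedAddCommGroup H] [InnerProductSpace ℂ H] [CompleteSpace H]
variable {K : Type v} [NormedAddCommGroup K] [InnerProductSpace ℂ K]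

/-- `R = tr_K (A)`: `A` is trace class on `H ⊗ K` and `R` is the (unique) trace class operator on
`H` such that `tr (R B) = tr (A (B ⊗ 1))` for all bounded operators `B` on `H`. -/
def IsPartialTrace (A : HTensor H K →L[ℂ] HTensor H K) (R : H →L[ℂ] H) : Prop :=
  IsTraceClass A ∧ IsTraceClass R ∧
    ∀ B : H →L[ℂ] H, opTrace (R ∘L B) = opTrace (A ∘L opTensor B (ContinuousLinearMap.id ℂ K))

theorem IsPartialTrace.unique {A : HTensor H K →L[ℂ] HTensor H K} {R R' : H →L[ℂ] H}
    (h : IsPartialTrace A R) (h' : IsPartialTrace A R') : R = R' := by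
  refine ContinuousLinearMap.ext fun x => ext_inner_left ℂ fun y => ?_
  rw [← opTrace_comp_rankOne, ← opTrace_comp_rankOne, h.2.2, h'.2.2]

end PartialTrace

/-! ### Quantum maps -/

section QuantumMap

variable {H : Type u} [NormedAddCommGroup H] [InnerProductSpace ℂ H]

/-- The operator `∑ₖₗ Aₖₗ ⊗ |eₖ⟩⟨eₗ|` on `H ⊗ ℂⁿ` with blocks `Aₖₗ`. -/
def blockOp {n : ℕ} (A : Fin n → Fin n → H →L[ℂ] H) :
    HTensor H (EuclideanSpace ℂ (Fin n)) →L[ℂ] HTensor H (EuclideanSpace ℂ (Fin n)) :=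
  ∑ k, ∑ l, opTensor (A k l)
    (rankOne ℂ (EuclideanSpace.single k (1 : ℂ)) (EuclideanSpace.single l (1 : ℂ)))

/-- Complete positivity. Every trace class operator on `H ⊗ ℂⁿ` is of the form
`∑ₖₗ Aₖₗ ⊗ |eₖ⟩⟨eₗ|` with unique trace class operators `Aₖₗ`, and `Φ ⊗ idₙ` maps it to
`∑ₖₗ Φ(Aₖₗ) ⊗ |eₖ⟩⟨eₗ|`. -/
def IsCompletelyPositive (Φ : traceClass H →ₗ[ℂ] traceClass H) : Prop :=
  ∀ (n : ℕ) (A : Fin n → Fin n → traceClass H),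
    (blockOp fun k l => (A k l : H →L[ℂ] H)).IsPositive →
      (blockOp fun k l => (Φ (A k l) : H →L[ℂ] H)).IsPositive

variable [CompleteSpace H]

/-- Completely positive and trace-preserving maps. -/
def IsCPTP (Φ : traceClass H →ₗ[ℂ] traceClass H) : Prop :=
  IsCompletelyPositive Φ ∧ ∀ ρ : traceClass H, opTrace (Φ ρ : H →L[ℂ] H) = opTrace (ρ : H →L[ℂ] H)

/-- `(Vⱼ)` is a family of Kraus operators of `Φ`: `Φ(ρ) = ∑ⱼ Vⱼ ρ Vⱼ*` in trace norm, and
`∑ⱼ Vⱼ* Vⱼ` converges strongly to a bounded operator. -/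
def IsKrausFamily {J : Type v} (Φ : traceClass H →ₗ[ℂ] traceClass H) (V : J → H →L[ℂ] H) : Prop :=
  (∀ ρ : traceClass H, Filter.Tendsto
      (fun F : Finset J => traceNorm ((Φ ρ : H →L[ℂ] H) -
        ∑ j ∈ F, V j ∘L (ρ : H →L[ℂ] H) ∘L ContinuousLinearMap.adjoint (V j)))
      Filter.atTop (nhds 0)) ∧
    ∃ S : H →L[ℂ] H, ∀ x : H, HasSum (fun j => ContinuousLinearMap.adjoint (V j) (V j x)) (S x)

/-- The unit vector `ψ ∈ K` and the unitary `U` on `H ⊗ K` give a Stinespring form of `Φ`: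
`Φ(ρ) = tr_K (U (ρ ⊗ |ψ⟩⟨ψ|) U*)` for all trace class `ρ`. -/
def IsStinespringForm {K : Type v} [NormedAddCommGroup K] [InnerProductSpace ℂ K]
    (Φ : traceClass H →ₗ[ℂ] traceClass H) (ψ : K) (U : HTensor H K →L[ℂ] HTensor H K) : Prop :=
  ‖ψ‖ = 1 ∧ U ∈ unitary (HTensor H K →L[ℂ] HTensor H K) ∧
    ∀ ρ : traceClass H, IsPartialTrace
      (U ∘L opTensor (ρ : H →L[ℂ] H) (rankOne ℂ ψ ψ) ∘L ContinuousLinearMap.adjoint U)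
      (Φ ρ : H →L[ℂ] H)

/-- The Hilbert space `ℓ²(J)`. -/
abbrev ell2 (J : Type v) : Type v := lp (fun _ : J => ℂ) 2

/-- The Hilbert space `ℂ²`. -/
abbrev Qubit : Type := EuclideanSpace ℂ (Fin 2)

open Classical in
/-- The standard basis vector `eⱼ` of `ℓ²(J)`. -/
def ell2Basis {J : Type v} (j : J) : ell2 J := lp.single 2 j (1 : ℂ)

/-- The first standard basis vector `e₁` of `ℂ²`. -/
def qubitOne : Qubit := EuclideanSpace.single 0 1

/-- The qubit is a catalyst for `U` (with `ℓ²(J)` prepared in `e_{j₀}`): for every state `ρ` on `H`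
there is a state `ω` on `H ⊗ ℓ²(J)` with
`U (ρ ⊗ |e_{j₀}⟩⟨e_{j₀}| ⊗ |e₁⟩⟨e₁|) U* = ω ⊗ |e₁⟩⟨e₁|`. -/
def IsQubitCatalyst {J : Type v} (j₀ : J)
    (U : HTensor H (HTensor (ell2 J) Qubit) →L[ℂ] HTensor H (HTensor (ell2 J) Qubit)) : Prop :=
  ∀ ρ : H →L[ℂ] H, IsState ρ → ∃ ω : HTensor H (ell2 J) →L[ℂ] HTensor H (ell2 J), IsState ω ∧
    U ∘L opTensor ρ (opTensor (rankOne ℂ (ell2Basis j₀) (ell2Basis j₀))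
        (rankOne ℂ qubitOne qubitOne)) ∘L ContinuousLinearMap.adjoint U =
      (hassoc H (ell2 J) Qubit).toContinuousLinearEquiv.toContinuousLinearMap ∘L
        opTensor ω (rankOne ℂ qubitOne qubitOne) ∘L
        (hassoc H (ell2 J) Qubit).symm.toContinuousLinearEquiv.toContinuousLinearMap

end QuantumMap

end

noncomputable section

/-! A Kraus family of a trace-preserving map satisfies `∑ⱼ ‖Vⱼ x‖² = ‖x‖²`, as one sees by taking
traces of `Φ(|x⟩⟨x|)`. Hence `T x = ∑ⱼ Vⱼ x ⊗ eⱼ` is an isometry from `H` to `H ⊗ ℓ²(J)`, and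
tracing out `ℓ²(J)` from `T ρ T*` returns `∑ⱼ Vⱼ ρ Vⱼ* = Φ(ρ)`. The operator `W : x ⊗ e_{j₀} ↦ T x`,
zero on the orthogonal complement of `H ⊗ e_{j₀}`, is a partial isometry. It need not extend to a
unitary on the same space, since the two orthogonal complements may differ in dimension. One extra
qubit removes the obstruction: the Halmos matrix with rows `(W, 1 - WW*)` and `(1 - W*W, -W*)` is
unitary and sends `x ⊗ e_{j₀} ⊗ e₁` to `T x ⊗ e₁`, so the qubit comes back unchanged
(`exists_unitary_dilation`, `IsKrausFamily.exists_stinespring`).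

Kraus operators exist because complete positivity says that the operator-valued kernel `(a, b) ↦
Φ(|a⟩⟨b|)` is positive semidefinite. The elements of its reproducing kernel Hilbert space are
bounded linear maps `H → H`, and Parseval's identity for an orthonormal basis of that space is the
Kraus formula on rank one operators (`IsCPTP.exists_isWeakKraus`).

No continuity of `Φ` is assumed. It is replaced by `‖Φ(ρ)‖ ≤ tr Φ(ρ) = tr ρ` for positive `ρ`, which
with polarization lets `Φ` pass through nuclear series (`IsCPTP.hasSum_rankOneTC`); absolute
summability of double series then gives convergence in trace norm. -/

theorem summable_mul_of_hasSum_sq {ι : Type*} {a b : ι → ℝ} {A B : ℝ} (ha : ∀ i, 0 ≤ a i)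
    (hb : ∀ i, 0 ≤ b i) (hA : HasSum (fun i => a i ^ 2) A) (hB : HasSum (fun i => b i ^ 2) B) :
    Summable (fun i => a i * b i) ∧ ∑' i, a i * b i ≤ √A * √B := by
  have key : ∀ F : Finset ι, ∑ i ∈ F, a i * b i ≤ √A * √B := fun F =>
    (Real.sum_mul_le_sqrt_mul_sqrt F a b).trans <| by
      gcongr
      · exact sum_le_hasSum F (fun i _ => sq_nonneg _) hA
      · exact sum_le_hasSum F (fun i _ => sq_nonneg _) hB
  exact ⟨summable_of_sum_le (fun i => mul_nonneg (ha i) (hb i)) key,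
    Real.tsum_le_of_sum_le (fun i => mul_nonneg (ha i) (hb i)) key⟩

theorem HilbertBasis.hasSum_norm_inner_sq {H : Type*} [NormedAddCommGroup H]
    [InnerProductSpace ℂ H] {β : Type*} (b : HilbertBasis β ℂ H) (z : H) :
    HasSum (fun k => ‖inner ℂ (b k) z‖ ^ 2) (‖z‖ ^ 2) := by
  have h := b.hasSum_inner_mul_inner z z
  rw [inner_self_eq_norm_sq_to_K] at h
  have h' := Complex.hasSum_re h
  convert! h' using 1
  · ext k
    rw [← RCLike.re_to_complex, inner_mul_symm_re_eq_norm, norm_mul, norm_inner_symm z, sq]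
  · norm_cast

/-! ### Nuclear series, the trace and its duality with bounded operators -/

section Nuclear

variable {H : Type u} [NormedAddCommGroup H] [InnerProductSpace ℂ H]
variable {E : Type v} [NormedAddCommGroup E] [InnerProductSpace ℂ E]
variable {ι κ : Type*}

/-- `T = ∑ᵢ |xᵢ⟩⟨yᵢ|` with `∑ᵢ ‖xᵢ‖ ‖yᵢ‖ < ∞`, over an arbitrary index type. -/
structure HasNuclearSum (x y : ι → H) (T : H →L[ℂ] H) : Prop where
  summable : Summable fun i => ‖x i‖ * ‖y i‖
  hasSum : HasSum (fun i => rankOne ℂ (x i) (y i)) T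

theorem IsNuclearRep.hasNuclearSum {T : H →L[ℂ] H} {x y : ℕ → H} {r : ℝ}
    (h : IsNuclearRep T x y r) : HasNuclearSum x y T := ⟨h.1.summable, h.2⟩

namespace HasNuclearSum

variable {x y : ι → H} {T : H →L[ℂ] H}

/-- A summable family has countable support, so the nonzero terms can be injected into `ℕ` and the
remaining places filled with zeros. Double series over pairs thereby yield trace norm bounds without
explicit enumeration. -/
theorem exists_isNuclearRep (h : HasNuclearSum x y T) :
    ∃ x' y' : ℕ → H, IsNuclearRep T x' y' (∑' i, ‖x i‖ * ‖y i‖) := by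
  let s : Set ι := Function.support fun i => ‖x i‖ * ‖y i‖
  have hs : Countable s := h.summable.countable_support
  obtain ⟨f, hf⟩ := hs.exists_injective_nat
  have hzero : ∀ n ∉ Set.range f, Function.extend f (fun i : s => x i) 0 n = 0 := fun n hn =>
    Function.extend_apply' _ _ _ hn
  refine ⟨Function.extend f (fun i : s => x i) 0, Function.extend f (fun i : s => y i) 0, ?_, ?_⟩
  · refine (hf.hasSum_iff fun n hn => by simp [hzero n hn]).1 ?_
    have h1 := (hasSum_subtype_iff_of_support_subset (s := s) subset_rfl).2 h.summable.hasSum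
    refine h1.congr_fun ?_
    intro i
    simp [hf.extend_apply]
  · refine (hf.hasSum_iff fun n hn => by simp [hzero n hn]).1 ?_
    have hsub : (Function.support fun i => rankOne ℂ (x i) (y i)) ⊆ s := by
      intro i hi
      simpa [s] using hi
    have h1 := (hasSum_subtype_iff_of_support_subset hsub).2 h.hasSum
    refine h1.congr_fun ?_
    intro i
    simp [hf.extend_apply]

theorem isTraceClass (h : HasNuclearSum x y T) : IsTraceClass T := by
  obtain ⟨x', y', h'⟩ := h.exists_isNuclearRep
  exact ⟨x', y', _, h'⟩

theorem traceNorm_le (h : HasNuclearSum x y T) : traceNorm T ≤ ∑' i, ‖x i‖ * ‖y i‖ := by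
  obtain ⟨x', y', h'⟩ := h.exists_isNuclearRep
  refine csInf_le ⟨0, ?_⟩ ⟨x', y', h'⟩
  rintro r ⟨a, b, hr, -⟩
  exact hr.nonneg fun n => by positivity

theorem of_summable [CompleteSpace H] (h : Summable fun i => ‖x i‖ * ‖y i‖) :
    HasNuclearSum x y (∑' i, rankOne ℂ (x i) (y i)) :=
  ⟨h, (Summable.of_norm (by simpa using h)).hasSum⟩

theorem comp [CompleteSpace H] [CompleteSpace E] (h : HasNuclearSum x y T) (A B : H →L[ℂ] E) :
    HasNuclearSum (fun i => A (x i)) (fun i => B (y i))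
      (A ∘L T ∘L ContinuousLinearMap.adjoint B) := by
  constructor
  · refine Summable.of_nonneg_of_le (fun i => by positivity) (fun i => ?_)
      (h.summable.mul_left (‖A‖ * ‖B‖))
    calc ‖A (x i)‖ * ‖B (y i)‖ ≤ (‖A‖ * ‖x i‖) * (‖B‖ * ‖y i‖) := by
          gcongr <;> exact ContinuousLinearMap.le_opNorm _ _
      _ = _ := by ring
  · have := ((ContinuousLinearMap.compL ℂ E H E A).comp
      ((ContinuousLinearMap.compL ℂ E H H).flip (ContinuousLinearMap.adjoint B))).hasSum h.hasSum
    refine this.congr_fun fun i => ?_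
    ext z
    simp [ContinuousLinearMap.adjoint_inner_right]

theorem const_rankOne (x y : H) :
    HasNuclearSum (fun _ : Unit => x) (fun _ : Unit => y) (rankOne ℂ x y) :=
  ⟨(hasSum_unique _).summable, hasSum_unique _⟩

/-- For each `i`, Cauchy–Schwarz and Parseval bound the sum over the basis by `‖yᵢ‖ ‖xᵢ‖`. The
double series may therefore be summed in either order, which makes the trace independent of basis
and representation. -/
theorem summable_inner (h : HasNuclearSum x y T) {β : Type*} (b : HilbertBasis β ℂ H) :
    Summable fun p : ι × β => inner ℂ (y p.1) (b p.2) * inner ℂ (b p.2) (x p.1) := by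
  refine Summable.of_norm ?_
  have key : ∀ i, Summable (fun k => ‖inner ℂ (y i) (b k)‖ * ‖inner ℂ (b k) (x i)‖) ∧
      ∑' k, ‖inner ℂ (y i) (b k)‖ * ‖inner ℂ (b k) (x i)‖ ≤ ‖y i‖ * ‖x i‖ := by
    intro i
    have h2 := b.hasSum_norm_inner_sq (y i)
    simp_rw [norm_inner_symm (b _) (y i)] at h2
    simpa using summable_mul_of_hasSum_sq (fun _ => norm_nonneg _) (fun _ => norm_nonneg _)
      h2 (b.hasSum_norm_inner_sq (x i))
  simp_rw [norm_mul]
  refine (summable_prod_of_nonneg fun p => by positivity).2 ⟨fun i => (key i).1, ?_⟩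
  refine Summable.of_nonneg_of_le (fun i => tsum_nonneg fun k => by positivity)
    (fun i => (key i).2) ?_
  simpa [mul_comm] using h.summable

theorem hasSum_diag (h : HasNuclearSum x y T) {β : Type*} (b : HilbertBasis β ℂ H) :
    HasSum (fun k => inner ℂ (b k) (T (b k))) (∑' i, inner ℂ (y i) (x i)) := by
  have h1 := (h.summable_inner b).hasSum
  have h2 := h1.prod_fiberwise fun i => b.hasSum_inner_mul_inner (y i) (x i)
  have h3 := (Equiv.prodComm β ι).hasSum_iff.2 h1
  rw [h2.tsum_eq]
  refine h3.prod_fiberwise fun k => ?_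
  have h4 := ((innerSL ℂ (b k)).comp (ContinuousLinearMap.apply ℂ H (b k))).hasSum h.hasSum
  simpa [inner_smul_right] using h4

variable [CompleteSpace H]

theorem hasSum_opTrace (h : HasNuclearSum x y T) :
    HasSum (fun i => inner ℂ (y i) (x i)) (opTrace T) := by
  rw [opTrace, (h.hasSum_diag (onb H)).tsum_eq]
  refine (Summable.of_norm_bounded h.summable fun i => ?_).hasSum
  rw [mul_comm]
  exact norm_inner_le_norm _ _

theorem hasSum_opTrace_comp (h : HasNuclearSum x y T) (B : H →L[ℂ] H) :
    HasSum (fun i => inner ℂ (y i) (B (x i))) (opTrace (T ∘L B)) := by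
  have h1 := h.comp (ContinuousLinearMap.id ℂ H) (ContinuousLinearMap.adjoint B)
  rw [ContinuousLinearMap.adjoint_adjoint, ContinuousLinearMap.id_comp] at h1
  simpa [ContinuousLinearMap.adjoint_inner_left] using h1.hasSum_opTrace

end HasNuclearSum

theorem traceNorm_nonneg (T : H →L[ℂ] H) : 0 ≤ traceNorm T := by
  refine Real.sInf_nonneg ?_
  rintro r ⟨a, b, hr, -⟩
  exact hr.nonneg fun n => by positivity

theorem IsTraceClass.sum {ι : Type*} {f : ι → H →L[ℂ] H} (s : Finset ι) (h : ∀ i ∈ s, IsTraceClass (f i)) :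
    IsTraceClass (∑ i ∈ s, f i) :=
  (traceClass H).sum_mem h

theorem isTraceClass_rankOne (x y : H) : IsTraceClass (rankOne ℂ x y) :=
  (HasNuclearSum.const_rankOne x y).isTraceClass

variable [CompleteSpace H]

namespace IsTraceClass

variable {S T : H →L[ℂ] H}

theorem comp_adjoint {E : Type v} [NormedAddCommGroup E] [InnerProductSpace ℂ E] [CompleteSpace E]
    (hT : IsTraceClass T) (A B : H →L[ℂ] E) :
    IsTraceClass (A ∘L T ∘L ContinuousLinearMap.adjoint B) := by
  obtain ⟨x, y, r, h⟩ := hT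
  exact (h.hasNuclearSum.comp A B).isTraceClass

theorem hasSum_diag (hT : IsTraceClass T) :
    HasSum (fun k => inner ℂ (onb H k) (T (onb H k))) (opTrace T) := by
  obtain ⟨x, y, r, h⟩ := hT
  exact (h.hasNuclearSum.hasSum_diag (onb H)).summable.hasSum

theorem opTrace_sub (hS : IsTraceClass S) (hT : IsTraceClass T) :
    opTrace (S - T) = opTrace S - opTrace T := by
  have := (hS.hasSum_diag.sub hT.hasSum_diag).tsum_eq
  simpa [opTrace, inner_sub_right] using this

theorem opTrace_sum {ι : Type*} {f : ι → H →L[ℂ] H} (s : Finset ι)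
    (h : ∀ i ∈ s, IsTraceClass (f i)) : opTrace (∑ i ∈ s, f i) = ∑ i ∈ s, opTrace (f i) := by
  have := (hasSum_sum fun i hi => (h i hi).hasSum_diag).tsum_eq
  simpa [opTrace, inner_sum] using this

/-- This is half of the duality between trace class and bounded operators: it turns trace norm
convergence into convergence of `tr(· B)`. -/
theorem norm_opTrace_comp_le (hT : IsTraceClass T) (B : H →L[ℂ] H) :
    ‖opTrace (T ∘L B)‖ ≤ traceNorm T * ‖B‖ := by
  obtain ⟨x₀, y₀, r₀, h₀⟩ := hT
  have hbound : ∀ r, (∃ x y, IsNuclearRep T x y r) → ‖opTrace (T ∘L B)‖ ≤ r * ‖B‖ := by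
    rintro r ⟨x, y, h⟩
    rw [← (h.hasNuclearSum.hasSum_opTrace_comp B).tsum_eq]
    refine tsum_of_norm_bounded (h.1.mul_right ‖B‖) fun i => ?_
    calc ‖inner ℂ (y i) (B (x i))‖ ≤ ‖y i‖ * ‖B (x i)‖ := norm_inner_le_norm _ _
      _ ≤ ‖y i‖ * (‖B‖ * ‖x i‖) := by gcongr; exact B.le_opNorm _
      _ = _ := by ring
  rcases (norm_nonneg B).eq_or_lt with hB | hB
  · simpa [← hB] using hbound r₀ ⟨x₀, y₀, h₀⟩
  · rw [← div_le_iff₀ hB]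
    refine le_csInf ⟨r₀, x₀, y₀, h₀⟩ fun r hr => ?_
    rw [div_le_iff₀ hB]
    exact hbound r hr

end IsTraceClass

theorem opTrace_rankOne (x y : H) : opTrace (rankOne ℂ x y) = inner ℂ y x := by
  simpa using opTrace_comp_rankOne (ContinuousLinearMap.id ℂ H) x y

end Nuclear

/-! ### Operators on Hilbert space tensor products -/

section Tensor

variable {H : Type u} [NormedAddCommGroup H] [InnerProductSpace ℂ H]
variable {K : Type v} [NormedAddCommGroup K] [InnerProductSpace ℂ K]
variable {L : Type w} [NormedAddCommGroup L] [InnerProductSpace ℂ L]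

theorem inner_htmul (x x' : H) (y y' : K) :
    inner ℂ (htmul x y) (htmul x' y') = inner ℂ x x' * inner ℂ y y' := by
  simp [htmul]

theorem norm_htmul (x : H) (y : K) : ‖htmul x y‖ = ‖x‖ * ‖y‖ := by
  simp [htmul]

variable (H) in
/-- The bounded operator `x ↦ x ⊗ y`. -/
def htmulRight (y : K) : H →L[ℂ] HTensor H K :=
  UniformSpace.Completion.toComplL ∘L (TensorProduct.mkL ℂ H K).flip y

@[simp]
theorem htmulRight_apply (x : H) (y : K) : htmulRight H y x = htmul x y := rfl

theorem ext_htmul {F : Type*} [NormedAddCommGroup F] [NormedSpace ℂ F]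
    {S T : HTensor H K →L[ℂ] F} (h : ∀ x y, S (htmul x y) = T (htmul x y)) : S = T := by
  ext z
  induction z using UniformSpace.Completion.induction_on with
  | hp => exact isClosed_eq S.continuous T.continuous
  | ih t =>
    induction t using TensorProduct.induction_on with
    | zero => rw [UniformSpace.Completion.coe_zero, map_zero, map_zero]
    | tmul x y => exact h x y
    | add a b ha hb => simp [UniformSpace.Completion.coe_add, ha, hb]

theorem htmul_add_left (x x' : H) (y : K) : htmul (x + x') y = htmul x y + htmul x' y :=
  map_add (htmulRight H y) x x'

theorem htmul_smul_left (c : ℂ) (x : H) (y : K) : htmul (c • x) y = c • htmul x y :=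
  map_smul (htmulRight H y) c x

theorem htmul_smul_right (c : ℂ) (x : H) (y : K) : htmul x (c • y) = c • htmul x y := by
  simp [htmul, UniformSpace.Completion.coe_smul]

@[simp]
theorem htmul_zero_left (y : K) : htmul (0 : H) y = 0 :=
  map_zero (htmulRight H y)

@[simp]
theorem htmul_zero_right (x : H) : htmul x (0 : K) = 0 := by
  simp [htmul, UniformSpace.Completion.coe_zero]

theorem htmul_add_right (x : H) (y y' : K) : htmul x (y + y') = htmul x y + htmul x y' := by
  simp [htmul, TensorProduct.tmul_add, UniformSpace.Completion.coe_add]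

theorem opTensor_rankOne (a b : H) (c d : K) :
    opTensor (rankOne ℂ a b) (rankOne ℂ c d) = rankOne ℂ (htmul a c) (htmul b d) :=
  ext_htmul fun x y => by
    simp [opTensor_htmul, inner_htmul, htmul_smul_left, htmul_smul_right, smul_smul, mul_comm]

theorem ext_htmul_inner {z z' : HTensor H K}
    (h : ∀ x y, inner ℂ (htmul x y) z = inner ℂ (htmul x y) z') : z = z' := by
  have : innerSL ℂ z = innerSL ℂ z' := ext_htmul fun x y => by
    simpa using congrArg (starRingEnd ℂ) (h x y)
  exact (innerSL_inj).1 this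

section Complete

variable [CompleteSpace H]

theorem adjoint_htmulRight_htmul (x : H) (y y' : K) :
    ContinuousLinearMap.adjoint (htmulRight H y) (htmul x y') = inner ℂ y y' • x := by
  refine ext_inner_left ℂ fun z => ?_
  rw [ContinuousLinearMap.adjoint_inner_right, htmulRight_apply, inner_htmul, inner_smul_right,
    mul_comm]

theorem opTensor_rankOne_right (A : H →L[ℂ] H) (c d : K) :
    opTensor A (rankOne ℂ c d) =
      htmulRight H c ∘L A ∘L ContinuousLinearMap.adjoint (htmulRight H d) :=
  ext_htmul fun x y => by
    simp [opTensor_htmul, adjoint_htmulRight_htmul, htmul_smul_right]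

theorem adjoint_opTensor [CompleteSpace K] (A : H →L[ℂ] H) (B : K →L[ℂ] K) :
    ContinuousLinearMap.adjoint (opTensor A B) =
      opTensor (ContinuousLinearMap.adjoint A) (ContinuousLinearMap.adjoint B) :=
  ext_htmul fun x y => ext_htmul_inner fun x' y' => by
    simp [ContinuousLinearMap.adjoint_inner_right, opTensor_htmul, inner_htmul]

end Complete

theorem hassoc_comp_opTensor (A : H →L[ℂ] H) (z : HTensor (HTensor H K) L) :
    opTensor A (ContinuousLinearMap.id ℂ (HTensor K L)) (hassoc H K L z) =
      hassoc H K L (opTensor (opTensor A (ContinuousLinearMap.id ℂ K))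
        (ContinuousLinearMap.id ℂ L) z) := by
  let T : HTensor (HTensor H K) L →L[ℂ] HTensor H (HTensor K L) :=
    (hassoc H K L).toContinuousLinearEquiv.toContinuousLinearMap
  have key : opTensor A (ContinuousLinearMap.id ℂ (HTensor K L)) ∘L T =
      T ∘L (opTensor (opTensor A (ContinuousLinearMap.id ℂ K)) (ContinuousLinearMap.id ℂ L)) := by
    refine ext_htmul fun z l => ?_
    have : (opTensor A (ContinuousLinearMap.id ℂ (HTensor K L)) ∘L T) ∘L htmulRight _ l =
      (T ∘L (opTensor (opTensor A (ContinuousLinearMap.id ℂ K)) (ContinuousLinearMap.id ℂ L))) ∘L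
        htmulRight _ l := ext_htmul fun x y => by
      simp [T, opTensor_htmul, hassoc_htmul]
    exact congrArg (fun S => S z) this
  exact congrArg (fun S => S z) key

theorem inner_hassoc_opTensor (A : H →L[ℂ] H) (z z' : HTensor H K) (l l' : L) :
    inner ℂ (hassoc H K L (htmul z l))
      (opTensor A (ContinuousLinearMap.id ℂ (HTensor K L)) (hassoc H K L (htmul z' l'))) =
      inner ℂ z (opTensor A (ContinuousLinearMap.id ℂ K) z') * inner ℂ l l' := by
  rw [hassoc_comp_opTensor, LinearIsometryEquiv.inner_map_map, opTensor_htmul, inner_htmul,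
    ContinuousLinearMap.id_apply]

/-! ### Conjugating a product state by a unitary known on one slice -/

section Conjugation

variable [CompleteSpace H] (T : H →ₗᵢ[ℂ] HTensor H K) (k : K) (l : L)
  {U : HTensor H (HTensor K L) →L[ℂ] HTensor H (HTensor K L)}

/-- The operator `x ↦ T x ⊗ l` from `H` to `H ⊗ (K ⊗ L)`. -/
def tensorRight : H →L[ℂ] HTensor H (HTensor K L) :=
  (hassoc H K L).toContinuousLinearEquiv.toContinuousLinearMap ∘L
    htmulRight _ l ∘L T.toContinuousLinearMap

variable {T k l}

/-- Since `ρ ⊗ |ψ⟩⟨ψ|` factors through `x ↦ x ⊗ ψ` on both sides, only the values of `U` on the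
slice `H ⊗ ψ` matter. -/
theorem conj_opTensor_rankOne
    (hU : ∀ x, U (htmul x (htmul k l)) = hassoc H K L (htmul (T x) l)) (ρ : H →L[ℂ] H) :
    U ∘L opTensor ρ (rankOne ℂ (htmul k l) (htmul k l)) ∘L ContinuousLinearMap.adjoint U =
      tensorRight T l ∘L ρ ∘L ContinuousLinearMap.adjoint (tensorRight T l) := by
  have hZ : U ∘L htmulRight H (htmul k l) = tensorRight T l := ContinuousLinearMap.ext hU
  rw [← hZ, opTensor_rankOne_right, ContinuousLinearMap.adjoint_comp]
  rfl

theorem conj_opTensor_rankOne_eq_hassoc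
    (hU : ∀ x, U (htmul x (htmul k l)) = hassoc H K L (htmul (T x) l)) (ρ : H →L[ℂ] H) :
    U ∘L opTensor ρ (opTensor (rankOne ℂ k k) (rankOne ℂ l l)) ∘L ContinuousLinearMap.adjoint U =
      (hassoc H K L).toContinuousLinearEquiv.toContinuousLinearMap ∘L
        opTensor (T.toContinuousLinearMap ∘L ρ ∘L
          ContinuousLinearMap.adjoint T.toContinuousLinearMap) (rankOne ℂ l l) ∘L
        (hassoc H K L).symm.toContinuousLinearEquiv.toContinuousLinearMap := by
  have ha : ContinuousLinearMap.adjoint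
      (hassoc H K L).toContinuousLinearEquiv.toContinuousLinearMap =
      (hassoc H K L).symm.toContinuousLinearEquiv.toContinuousLinearMap :=
    (hassoc H K L).adjoint_eq_symm
  have hZ : ContinuousLinearMap.adjoint (tensorRight T l) =
      ContinuousLinearMap.adjoint T.toContinuousLinearMap ∘L
        ContinuousLinearMap.adjoint (htmulRight (HTensor H K) l) ∘L
        (hassoc H K L).symm.toContinuousLinearEquiv.toContinuousLinearMap := by
    refine (ContinuousLinearMap.adjoint_comp _ _).trans ?_
    rw [ha, ContinuousLinearMap.adjoint_comp (htmulRight (HTensor H K) l) T.toContinuousLinearMap]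
    rfl
  rw [opTensor_rankOne, conj_opTensor_rankOne hU, opTensor_rankOne_right, hZ]
  rfl

end Conjugation

end Tensor

/-! ### Halmos dilation of a partial isometry -/

section Dilation

/-- The Halmos dilation of a partial isometry, relative to a system of `2 × 2` matrix units. -/
theorem mem_unitary_of_matrixUnits {R A : Type*} [Ring R] [StarRing R] [Ring A] [StarRing A]
    (t : Fin 2 → Fin 2 → R →+ A)
    (hmul : ∀ i j k l a b, t i j a * t k l b = if j = k then t i l (a * b) else 0)
    (hstar : ∀ i j a, star (t i j a) = t j i (star a)) (hone : t 0 0 1 + t 1 1 1 = 1)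
    (w : R) (hw : w * star w * w = w) :
    t 0 0 w + t 0 1 (1 - w * star w) + t 1 0 (1 - star w * w) - t 1 1 (star w) ∈ unitary A := by
  have hw' : star w * w * star w = star w := by
    simpa [mul_assoc] using congrArg star hw
  have h1 : star w * (w * star w) = star w := by rw [← mul_assoc, hw']
  have h2 : w * (star w * w) = w := by rw [← mul_assoc, hw]
  -- With `1` written as the sum of the diagonal units, both products are compared block by block.
  -- The off-diagonal blocks vanish because `w (1 - w* w) = 0`, and the diagonal ones are sums of
  -- complementary projections.
  rw [Unitary.mem_iff, ← hone]
  constructor <;>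
  · simp [hstar, mul_add, add_mul, mul_sub, sub_mul, hmul, mul_assoc, h1, h2]
    try abel

variable {E : Type u} [NormedAddCommGroup E] [InnerProductSpace ℂ E]

/-- The operator on `E ⊗ ℂ²` with `A` in the `(i, j)` block and zeros elsewhere. -/
def qubitBlock (i j : Fin 2) : (E →L[ℂ] E) →ₗ[ℂ] (HTensor E Qubit →L[ℂ] HTensor E Qubit) where
  toFun A := opTensor A (rankOne ℂ (EuclideanSpace.single i (1 : ℂ))
    (EuclideanSpace.single j (1 : ℂ)))
  map_add' A B := ext_htmul fun x y => by simp [opTensor_htmul, htmul_add_left]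
  map_smul' c A := ext_htmul fun x y => by simp [opTensor_htmul, htmul_smul_left]

theorem qubitBlock_mul (A B : E →L[ℂ] E) (i j k l : Fin 2) :
    qubitBlock i j A * qubitBlock k l B = if j = k then qubitBlock i l (A * B) else 0 := by
  refine ext_htmul fun x y => ?_
  split_ifs with h
  · subst h
    simp [qubitBlock, opTensor_htmul]
  · simp [qubitBlock, opTensor_htmul, EuclideanSpace.inner_single_left, Ne.symm h]

theorem qubitBlock_one_add : qubitBlock 0 0 (1 : E →L[ℂ] E) + qubitBlock 1 1 1 = 1 := by
  refine ext_htmul fun x y => ?_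
  have hy : y = y 0 • EuclideanSpace.single 0 (1 : ℂ) + y 1 • EuclideanSpace.single 1 (1 : ℂ) := by
    ext i
    fin_cases i <;> simp
  conv_rhs => rw [hy]
  simp [qubitBlock, opTensor_htmul, htmul_add_right, EuclideanSpace.inner_single_left]

theorem qubitBlock_htmul_qubitOne (A : E →L[ℂ] E) (i : Fin 2) (x : E) :
    qubitBlock i 0 A (htmul x qubitOne) = htmul (A x) (EuclideanSpace.single i 1) := by
  simp [qubitBlock, qubitOne, opTensor_htmul]

theorem qubitBlock_one_htmul_qubitOne (A : E →L[ℂ] E) (i : Fin 2) (x : E) :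
    qubitBlock i 1 A (htmul x qubitOne) = 0 := by
  simp [qubitBlock, qubitOne, opTensor_htmul, EuclideanSpace.inner_single_left]

variable [CompleteSpace E]

theorem star_qubitBlock (A : E →L[ℂ] E) (i j : Fin 2) :
    star (qubitBlock i j A) = qubitBlock j i (star A) := by
  simp [qubitBlock, ContinuousLinearMap.star_eq_adjoint, adjoint_opTensor]

/-- A partial isometry `W` on `E` extends to a unitary operator on `E ⊗ ℂ²`. -/
theorem exists_unitary_dilation (W : E →L[ℂ] E) (hW : W * star W * W = W) :
    ∃ U ∈ unitary (HTensor E Qubit →L[ℂ] HTensor E Qubit), ∀ x, (star W * W) x = x →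
      U (htmul x qubitOne) = htmul (W x) qubitOne := by
  -- On vectors fixed by `W* W` the lower left block `1 - W* W` vanishes, so the qubit stays in
  -- `e₁`.
  refine ⟨qubitBlock 0 0 W + qubitBlock 0 1 (1 - W * star W) + qubitBlock 1 0 (1 - star W * W)
    - qubitBlock 1 1 (star W), ?_, fun x hx => ?_⟩
  · exact mem_unitary_of_matrixUnits (fun i j => (qubitBlock (E := E) i j).toAddMonoidHom)
      (fun i j k l A B => qubitBlock_mul A B i j k l) (fun i j A => star_qubitBlock A i j)
      qubitBlock_one_add W hW
  · simp only [sub_apply, add_apply,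
      qubitBlock_htmul_qubitOne, qubitBlock_one_htmul_qubitOne, hx, one_apply_eq_self]
    simp [qubitOne]

end Dilation

theorem LinearIsometryEquiv.conjStarAlgEquiv_mem_unitary {E F : Type*} [NormedAddCommGroup E]
    [InnerProductSpace ℂ E] [CompleteSpace E] [NormedAddCommGroup F] [InnerProductSpace ℂ F]
    [CompleteSpace F] (e : E ≃ₗᵢ[ℂ] F) {U : E →L[ℂ] E} (hU : U ∈ unitary (E →L[ℂ] E)) :
    e.conjStarAlgEquiv U ∈ unitary (F →L[ℂ] F) :=
  Unitary.map_mem e.conjStarAlgEquiv hU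

theorem IsState.comp_isometry {E : Type u} {F : Type v} [NormedAddCommGroup E]
    [InnerProductSpace ℂ E] [CompleteSpace E] [NormedAddCommGroup F] [InnerProductSpace ℂ F]
    [CompleteSpace F] {ρ : E →L[ℂ] E} (hρ : IsState ρ) (T : E →ₗᵢ[ℂ] F) :
    IsState (T.toContinuousLinearMap ∘L ρ ∘L
      ContinuousLinearMap.adjoint T.toContinuousLinearMap) := by
  refine ⟨hρ.1.comp_adjoint _ _, hρ.2.1.conj_adjoint _, ?_⟩
  obtain ⟨x, y, r, hxy⟩ := hρ.1
  rw [← hρ.2.2]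
  refine (hxy.hasNuclearSum.comp _ _).hasSum_opTrace.unique
    (hxy.hasNuclearSum.hasSum_opTrace.congr_fun fun n => ?_)
  exact T.inner_map_map _ _

/-! ### From Kraus operators to the unitary -/

section Kraus

variable {H : Type u} [NormedAddCommGroup H] [InnerProductSpace ℂ H]
variable {J : Type v}

theorem inner_ell2Basis_left (j : J) (f : ell2 J) : inner ℂ (ell2Basis j) f = f j := by
  classical
  have := lp.inner_single_left (𝕜 := ℂ) j (1 : ℂ) f
  simpa [ell2Basis] using this

theorem inner_ell2Basis [DecidableEq J] (i j : J) :
    inner ℂ (ell2Basis i) (ell2Basis j) = if i = j then (1 : ℂ) else 0 := by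
  rw [inner_ell2Basis_left]
  simp [ell2Basis, lp.single_apply, Pi.single_apply]

theorem norm_ell2Basis (j : J) : ‖ell2Basis j‖ = 1 := by
  classical
  simp [ell2Basis]

theorem norm_qubitOne : ‖qubitOne‖ = 1 := by simp [qubitOne]

/-- The isometric embedding `x ↦ x ⊗ eⱼ`. -/
def htmulBasis (j : J) : H →ₗᵢ[ℂ] HTensor H (ell2 J) where
  toLinearMap := htmulRight H (ell2Basis j)
  norm_map' x := by
    change ‖htmul x (ell2Basis j)‖ = ‖x‖
    rw [norm_htmul, norm_ell2Basis, mul_one]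

theorem orthogonalFamily_htmulBasis :
    OrthogonalFamily ℂ (fun _ : J => H) (fun j => htmulBasis (H := H) j) := by
  classical
  intro i j hij x y
  change inner ℂ (htmul x (ell2Basis i)) (htmul y (ell2Basis j)) = 0
  rw [inner_htmul, inner_ell2Basis, if_neg hij, mul_zero]

/-- `∑ⱼ Vⱼ* Vⱼ = 1`, in the weak sense. -/
def IsResolution (V : J → H →L[ℂ] H) : Prop :=
  ∀ x, HasSum (fun j => ‖V j x‖ ^ 2) (‖x‖ ^ 2)

variable {V : J → H →L[ℂ] H}

theorem IsResolution.memℓp (hV : IsResolution V) (x : H) : Memℓp (fun j => V j x) 2 := by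
  rw [memℓp_gen_iff (by simp)]
  simpa using (hV x).summable

/-- The isometry from `H` to the Hilbert sum of copies of `H` given by `x ↦ (Vⱼ x)ⱼ`. -/
def IsResolution.toLp (hV : IsResolution V) : H →ₗᵢ[ℂ] lp (fun _ : J => H) 2 where
  toFun x := ⟨fun j => V j x, hV.memℓp x⟩
  map_add' x y := lp.ext (funext fun j => map_add (V j) x y)
  map_smul' c x := lp.ext (funext fun j => map_smul (V j) c x)
  norm_map' x := by
    have h := lp.hasSum_norm (p := 2) (by simp)
      (⟨fun j => V j x, hV.memℓp x⟩ : lp (fun _ : J => H) 2)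
    simp only [ENNReal.toReal_ofNat, Real.rpow_ofNat] at h
    exact (sq_eq_sq₀ (norm_nonneg _) (norm_nonneg _)).1 (h.unique (hV x))

/-- The isometry `x ↦ ∑ⱼ Vⱼ x ⊗ eⱼ`. -/
def IsResolution.isometry (hV : IsResolution V) : H →ₗᵢ[ℂ] HTensor H (ell2 J) :=
  orthogonalFamily_htmulBasis.linearIsometry.comp hV.toLp

namespace IsResolution

theorem hasSum_isometry (hV : IsResolution V) (x : H) :
    HasSum (fun j => htmul (V j x) (ell2Basis j)) (hV.isometry x) :=
  orthogonalFamily_htmulBasis.hasSum_linearIsometry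
    (hV.toLp x)

theorem inner_htmul_isometry (hV : IsResolution V) (x y : H) (j : J) :
    inner ℂ (htmul x (ell2Basis j)) (hV.isometry y) = inner ℂ x (V j y) := by
  classical
  have h := (innerSL ℂ (htmul x (ell2Basis j))).hasSum (hV.hasSum_isometry y)
  refine h.unique ?_
  convert! hasSum_ite_eq j (inner ℂ x (V j y)) using 2 with i
  simp only [innerSL_apply_apply, inner_htmul, inner_ell2Basis]
  by_cases hij : i = j
  · simp [hij]
  · simp [hij, Ne.symm hij]

/-- This is the partial trace over `ℓ²(J)` at the level of vectors: expanding `T x` and pairing each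
term with `T y` leaves only the diagonal in `J`. -/
theorem hasSum_inner_opTensor (hV : IsResolution V) (B : H →L[ℂ] H) (x y : H) :
    HasSum (fun j => inner ℂ (V j y) (B (V j x)))
      (inner ℂ (hV.isometry y) (opTensor B (ContinuousLinearMap.id ℂ (ell2 J)) (hV.isometry x))) := by
  have h := ((innerSL ℂ (hV.isometry y)).comp
    (opTensor B (ContinuousLinearMap.id ℂ (ell2 J)))).hasSum (hV.hasSum_isometry x)
  refine h.congr_fun fun j => ?_
  simp only [ContinuousLinearMap.comp_apply, opTensor_htmul, innerSL_apply_apply,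
    ContinuousLinearMap.id_apply]
  rw [← inner_conj_symm (hV.isometry y), inner_htmul_isometry, inner_conj_symm]

/-- Apply `T*` to the series for `T x`: the terms become `Vⱼ* Vⱼ x`, and `T* T = 1`. -/
theorem hasSum_adjoint_apply [CompleteSpace H] (hV : IsResolution V) (x : H) :
    HasSum (fun j => ContinuousLinearMap.adjoint (V j) (V j x)) x := by
  have h := (ContinuousLinearMap.adjoint hV.isometry.toContinuousLinearMap).hasSum
    (hV.hasSum_isometry x)
  convert! h using 1
  · ext j
    refine ext_inner_right ℂ fun z => ?_
    rw [ContinuousLinearMap.adjoint_inner_left, ContinuousLinearMap.adjoint_inner_left]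
    exact (hV.inner_htmul_isometry _ _ _).symm
  · refine ext_inner_right ℂ fun z => ?_
    rw [ContinuousLinearMap.adjoint_inner_left]
    exact (hV.isometry.inner_map_map x z).symm

/-- Summability of `‖Vⱼ xₙ‖ ‖Vⱼ yₙ‖` over all pairs `(n, j)`. -/
theorem summable_prod (hV : IsResolution V) {ι : Type*} {x y : ι → H}
    (h : Summable fun i => ‖x i‖ * ‖y i‖) :
    Summable fun p : ι × J => ‖V p.2 (x p.1)‖ * ‖V p.2 (y p.1)‖ := by
  have key : ∀ i, Summable (fun j => ‖V j (x i)‖ * ‖V j (y i)‖) ∧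
      ∑' j, ‖V j (x i)‖ * ‖V j (y i)‖ ≤ ‖x i‖ * ‖y i‖ := fun i => by
    simpa using summable_mul_of_hasSum_sq (fun _ => norm_nonneg _) (fun _ => norm_nonneg _)
      (hV (x i)) (hV (y i))
  refine (summable_prod_of_nonneg fun p => by positivity).2 ⟨fun i => (key i).1, ?_⟩
  exact h.of_nonneg_of_le (fun i => tsum_nonneg fun j => by positivity) fun i => (key i).2

end IsResolution

variable [CompleteSpace H] {Φ : traceClass H →ₗ[ℂ] traceClass H}

theorem IsKrausFamily.hasSum_opTrace_comp (hV : IsKrausFamily Φ V) (ρ : traceClass H)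
    (B : H →L[ℂ] H) :
    HasSum (fun j => opTrace ((V j ∘L (ρ : H →L[ℂ] H) ∘L ContinuousLinearMap.adjoint (V j)) ∘L B))
      (opTrace ((Φ ρ : H →L[ℂ] H) ∘L B)) := by
  have htc : ∀ j, IsTraceClass (V j ∘L (ρ : H →L[ℂ] H) ∘L ContinuousLinearMap.adjoint (V j)) :=
    fun j => ρ.2.comp_adjoint _ _
  have htcB : ∀ {T : H →L[ℂ] H}, IsTraceClass T → IsTraceClass (T ∘L B) := fun hT => by
    simpa using hT.comp_adjoint (ContinuousLinearMap.id ℂ H) (ContinuousLinearMap.adjoint B)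
  rw [HasSum, tendsto_iff_norm_sub_tendsto_zero]
  refine squeeze_zero (fun _ => norm_nonneg _) (fun F => ?_) (by simpa using (hV.1 ρ).mul_const ‖B‖)
  rw [← IsTraceClass.opTrace_sum F fun j _ => htcB (htc j), norm_sub_rev,
    ← IsTraceClass.opTrace_sub (htcB (Φ ρ).2) (IsTraceClass.sum F fun j _ => htcB (htc j))]
  have hF : IsTraceClass ((Φ ρ : H →L[ℂ] H) -
      ∑ j ∈ F, V j ∘L (ρ : H →L[ℂ] H) ∘L ContinuousLinearMap.adjoint (V j)) :=
    (traceClass H).sub_mem (Φ ρ).2 (IsTraceClass.sum F fun j _ => htc j)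
  have h := hF.norm_opTrace_comp_le B
  rwa [ContinuousLinearMap.sub_comp, ContinuousLinearMap.finsetSum_comp] at h

theorem IsKrausFamily.isResolution (hΦ : IsCPTP Φ) (hV : IsKrausFamily Φ V) : IsResolution V := by
  intro x
  have h := hV.hasSum_opTrace_comp ⟨rankOne ℂ x x, isTraceClass_rankOne x x⟩
    (ContinuousLinearMap.id ℂ H)
  simp only [ContinuousLinearMap.comp_id] at h
  rw [hΦ.2, opTrace_rankOne, inner_self_eq_norm_sq_to_K] at h
  have h' := Complex.hasSum_re h
  convert! h' using 1
  · ext j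
    have h1 := (HasNuclearSum.const_rankOne x x).comp (V j) (V j)
    rw [h1.hasSum_opTrace.unique (hasSum_unique _), inner_self_eq_norm_sq_to_K]
    norm_cast
  · norm_cast

/-- The unitary dilation of the isometry `x ↦ ∑ⱼ Vⱼ x ⊗ eⱼ`. -/
theorem IsResolution.exists_unitary (hV : IsResolution V) (j₀ : J) :
    ∃ U ∈ unitary (HTensor H (HTensor (ell2 J) Qubit) →L[ℂ] HTensor H (HTensor (ell2 J) Qubit)),
      ∀ x : H, U (htmul x (htmul (ell2Basis j₀) qubitOne)) =
        hassoc H (ell2 J) Qubit (htmul (hV.isometry x) qubitOne) := by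
  let T : H →L[ℂ] HTensor H (ell2 J) := hV.isometry.toContinuousLinearMap
  let e : H →L[ℂ] HTensor H (ell2 J) := htmulRight H (ell2Basis j₀)
  have hT : ∀ x, ContinuousLinearMap.adjoint T (T x) = x := fun x =>
    ext_inner_right ℂ fun z => by
      rw [ContinuousLinearMap.adjoint_inner_left]
      exact hV.isometry.inner_map_map x z
  have he : ∀ x, ContinuousLinearMap.adjoint e (e x) = x := fun x => by
    simp [e, adjoint_htmulRight_htmul, norm_ell2Basis]
  -- `W* W = e e*` is the projection onto `H ⊗ e_{j₀}`, because both `T` and `e` are isometries.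
  let W := T ∘L ContinuousLinearMap.adjoint e
  have hW : ∀ z, star W z = e (ContinuousLinearMap.adjoint T z) := fun z => by
    simp [W, ContinuousLinearMap.star_eq_adjoint, ContinuousLinearMap.adjoint_comp]
  obtain ⟨U, hU, hUW⟩ := exists_unitary_dilation W (by
    ext1 z
    change W (star W (W z)) = W z
    rw [hW]
    simp [W, hT, he])
  refine ⟨(hassoc H (ell2 J) Qubit).conjStarAlgEquiv U, ?_, fun x => ?_⟩
  · exact (hassoc H (ell2 J) Qubit).conjStarAlgEquiv_mem_unitary hU
  · rw [LinearIsometryEquiv.conjStarAlgEquiv_apply_apply, ← hassoc_htmul,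
      LinearIsometryEquiv.symm_apply_apply]
    have hWx : W (e x) = hV.isometry x := by simp [W, he, T]
    have := hUW (e x) (by
      change star W (W (e x)) = e x
      rw [hW]
      simp [W, hT, he])
    rw [hWx] at this
    exact congrArg _ this

theorem IsKrausFamily.exists_stinespring (hΦ : IsCPTP Φ) (hV : IsKrausFamily Φ V) (j₀ : J) :
    ∃ U : HTensor H (HTensor (ell2 J) Qubit) →L[ℂ] HTensor H (HTensor (ell2 J) Qubit),
      IsStinespringForm Φ (htmul (ell2Basis j₀) qubitOne) U ∧ IsQubitCatalyst j₀ U := by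
  have hc := hV.isResolution hΦ
  obtain ⟨U, hU, hUx⟩ := hc.exists_unitary j₀
  let Z := tensorRight hc.isometry qubitOne
  refine ⟨U, ⟨?_, hU, fun ρ => ?_⟩, fun ρ hρ => ⟨_, hρ.comp_isometry hc.isometry,
    conj_opTensor_rankOne_eq_hassoc hUx ρ⟩⟩
  · rw [norm_htmul, norm_ell2Basis, norm_qubitOne, mul_one]
  · rw [conj_opTensor_rankOne hUx]
    refine ⟨ρ.2.comp_adjoint Z Z, (Φ ρ).2, fun B => ?_⟩
    obtain ⟨x, y, r, hxy⟩ := ρ.2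
    replace hxy := hxy.hasNuclearSum
    -- The family is absolutely summable over pairs `(n, j)`. Summing over `j` first gives the trace
    -- on the dilated space; summing over `n` first gives `∑ⱼ tr(Vⱼ ρ Vⱼ* B)`.
    have hsum : Summable fun p : ℕ × J => inner ℂ (V p.2 (y p.1)) (B (V p.2 (x p.1))) := by
      refine Summable.of_norm_bounded ((hc.summable_prod hxy.summable).mul_left ‖B‖) fun p => ?_
      calc ‖inner ℂ (V p.2 (y p.1)) (B (V p.2 (x p.1)))‖
          ≤ ‖V p.2 (y p.1)‖ * ‖B (V p.2 (x p.1))‖ := norm_inner_le_norm _ _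
        _ ≤ ‖V p.2 (y p.1)‖ * (‖B‖ * ‖V p.2 (x p.1)‖) := by gcongr; exact B.le_opNorm _
        _ = _ := by ring
    have h1 := hsum.hasSum.prod_fiberwise fun n => hc.hasSum_inner_opTensor B (x n) (y n)
    have h2 := ((Equiv.prodComm J ℕ).hasSum_iff.2 hsum.hasSum).prod_fiberwise fun j =>
      (hxy.comp (V j) (V j)).hasSum_opTrace_comp B
    rw [(hV.hasSum_opTrace_comp ρ B).unique h2]
    refine h1.unique (((hxy.comp Z Z).hasSum_opTrace_comp _).congr_fun fun n => ?_)
    refine Eq.trans ?_ (inner_hassoc_opTensor B (hc.isometry (y n)) (hc.isometry (x n))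
      qubitOne qubitOne).symm
    rw [inner_self_eq_norm_sq_to_K, norm_qubitOne]
    simp

end Kraus

/-! ### Positive operators, polarization and rescaling -/

section Positive

variable {H : Type u} [NormedAddCommGroup H] [InnerProductSpace ℂ H]

theorem ContinuousLinearMap.isPositive_of_hasSum {ι : Type*} {f : ι → H →L[ℂ] H} {T : H →L[ℂ] H}
    (hf : ∀ i, (f i).IsPositive) (h : HasSum f T) : T.IsPositive := by
  rw [ContinuousLinearMap.isPositive_iff_complex]
  intro x
  have h1 : HasSum (fun i => inner ℂ x (f i x)) (inner ℂ x (T x)) :=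
    ((innerSL ℂ x).comp (ContinuousLinearMap.apply ℂ H x)).hasSum h
  have h2 : HasSum (fun i => inner ℂ (f i x) x) (inner ℂ (T x) x) := by
    have := h1.map (starRingEnd ℂ) Complex.continuous_conj
    simpa [Function.comp_def] using this
  have h3 := Complex.hasSum_re h2
  refine ⟨(Complex.hasSum_ofReal.2 h3).unique ?_, h3.nonneg fun i => (hf i).re_inner_nonneg_left x⟩
  refine h2.congr_fun fun i => ?_
  exact ((ContinuousLinearMap.isPositive_iff_complex _).1 (hf i) x).1

/-- The rank one operator `|x⟩⟨y|` as a trace class operator. -/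
def rankOneTC (x y : H) : traceClass H := ⟨rankOne ℂ x y, isTraceClass_rankOne x y⟩

@[simp]
theorem coe_rankOneTC (x y : H) : (rankOneTC x y : H →L[ℂ] H) = rankOne ℂ x y := rfl

theorem rankOneTC_polarization (x y : H) :
    (4 : ℂ) • rankOneTC x y = rankOneTC (x + y) (x + y) - rankOneTC (x - y) (x - y) +
      Complex.I • rankOneTC (x + Complex.I • y) (x + Complex.I • y) -
      Complex.I • rankOneTC (x - Complex.I • y) (x - Complex.I • y) := by
  refine Subtype.ext (ContinuousLinearMap.ext fun z => ?_)
  simp only [SetLike.val_smul, AddSubgroupClass.coe_sub, Submodule.coe_add, coe_rankOneTC,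
    smul_apply, sub_apply, add_apply, InnerProductSpace.rankOne_apply, inner_add_left,
    inner_sub_left, inner_smul_left, Complex.conj_I]
  match_scalars
  · linear_combination (2 * inner ℂ y z) * Complex.I_sq
  · linear_combination (-2 * inner ℂ x z) * Complex.I_sq

theorem rankOneTC_polarization_symm (x y : H) :
    (4 : ℂ) • rankOneTC y x = rankOneTC (x + y) (x + y) - rankOneTC (x - y) (x - y) -
      Complex.I • rankOneTC (x + Complex.I • y) (x + Complex.I • y) +
      Complex.I • rankOneTC (x - Complex.I • y) (x - Complex.I • y) := by
  refine Subtype.ext (ContinuousLinearMap.ext fun z => ?_)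
  simp only [SetLike.val_smul, AddSubgroupClass.coe_sub, Submodule.coe_add, coe_rankOneTC,
    smul_apply, sub_apply, add_apply, InnerProductSpace.rankOne_apply, inner_add_left,
    inner_sub_left, inner_smul_left, Complex.conj_I]
  match_scalars
  · linear_combination (2 * inner ℂ x z) * Complex.I_sq
  · linear_combination (-2 * inner ℂ y z) * Complex.I_sq

/-- Rescaling makes both factors of a nuclear series square summable, so that the vectors `x' ± y'`,
`x' ± i y'` of the polarization identity give nuclear series too. -/
theorem exists_balanced (x y : H) : ∃ x' y' : H, rankOneTC x' y' = rankOneTC x y ∧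
    ‖x'‖ ^ 2 = ‖x‖ * ‖y‖ ∧ ‖y'‖ ^ 2 = ‖x‖ * ‖y‖ := by
  by_cases hx : x = 0
  · exact ⟨0, 0, Subtype.ext (by simp [hx]), by simp [hx], by simp [hx]⟩
  by_cases hy : y = 0
  · exact ⟨0, 0, Subtype.ext (by simp [hy]), by simp [hy], by simp [hy]⟩
  have hx' : 0 < ‖x‖ := norm_pos_iff.2 hx
  have hy' : 0 < ‖y‖ := norm_pos_iff.2 hy
  obtain ⟨c, hc, hc2⟩ : ∃ c : ℝ, 0 < c ∧ c ^ 2 = ‖y‖ / ‖x‖ :=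
    ⟨√(‖y‖ / ‖x‖), Real.sqrt_pos.2 (by positivity), Real.sq_sqrt (by positivity)⟩
  have hc0 : (c : ℂ) ≠ 0 := by exact_mod_cast hc.ne'
  refine ⟨(c : ℂ) • x, (c : ℂ)⁻¹ • y, Subtype.ext ?_, ?_, ?_⟩
  · ext z
    rw [coe_rankOneTC, coe_rankOneTC, InnerProductSpace.rankOne_apply,
      InnerProductSpace.rankOne_apply, inner_smul_left, smul_smul, map_inv₀, Complex.conj_ofReal,
      mul_right_comm, inv_mul_cancel₀ hc0, one_mul]
  · rw [norm_smul, mul_pow, Complex.norm_real, Real.norm_of_nonneg hc.le, hc2]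
    field_simp
  · rw [norm_smul, mul_pow, norm_inv, Complex.norm_real, Real.norm_of_nonneg hc.le, inv_pow, hc2]
    field_simp

variable [CompleteSpace H]

/-- Write `P = B* B`. Then `tr P = ∑ₖ ‖B eₖ‖²`, while Parseval gives `‖B* w‖² = ∑ₖ |⟪B eₖ, w⟫|²`,
which is at most `‖w‖² tr P`. -/
theorem IsTraceClass.norm_le_re_opTrace {P : H →L[ℂ] H} (hP : IsTraceClass P)
    (hpos : P.IsPositive) : ‖P‖ ≤ (opTrace P).re := by
  obtain ⟨B, rfl⟩ := CStarAlgebra.nonneg_iff_eq_star_mul_self.1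
    ((ContinuousLinearMap.nonneg_iff_isPositive P).2 hpos)
  have h1 : HasSum (fun k => ‖B (onb H k)‖ ^ 2) (opTrace (star B * B)).re := by
    refine (Complex.hasSum_re hP.hasSum_diag).congr_fun fun k => ?_
    change _ = (inner ℂ (onb H k) (ContinuousLinearMap.adjoint B (B (onb H k)))).re
    rw [ContinuousLinearMap.adjoint_inner_right, inner_self_eq_norm_sq_to_K]
    norm_cast
  have h0 : 0 ≤ (opTrace (star B * B)).re := h1.nonneg fun k => sq_nonneg _
  have h2 : ‖star B‖ ≤ √(opTrace (star B * B)).re := by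
    refine ContinuousLinearMap.opNorm_le_bound _ (Real.sqrt_nonneg _) fun w => ?_
    refine (sq_le_sq₀ (norm_nonneg _) (by positivity)).1 ?_
    rw [mul_pow, Real.sq_sqrt h0]
    refine hasSum_le (fun k => ?_) ((onb H).hasSum_norm_inner_sq (star B w)) (h1.mul_right _)
    rw [← mul_pow]
    gcongr
    rw [ContinuousLinearMap.star_eq_adjoint, ContinuousLinearMap.adjoint_inner_right]
    exact norm_inner_le_norm _ _
  rw [CStarRing.norm_star_mul_self, ← norm_star B]
  exact (mul_self_le_mul_self (norm_nonneg _) h2).trans (Real.mul_self_sqrt h0).le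

end Positive

/-! ### Consequences of complete positivity -/

section CompletelyPositive

variable {H : Type u} [NormedAddCommGroup H] [InnerProductSpace ℂ H]
variable {Φ : traceClass H →ₗ[ℂ] traceClass H}

theorem rankOne_sum_sum {n : ℕ} {F : Type*} [NormedAddCommGroup F] [InnerProductSpace ℂ F]
    (t : Fin n → F) : ∑ k, ∑ l, rankOne ℂ (t k) (t l) = rankOne ℂ (∑ k, t k) (∑ k, t k) := by
  simp only [map_sum, sum_apply]
  exact Finset.sum_comm

theorem inner_blockOp {n : ℕ} (A : Fin n → Fin n → H →L[ℂ] H) (w : Fin n → H) :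
    inner ℂ (∑ k, htmul (w k) (EuclideanSpace.single k (1 : ℂ)))
      (blockOp A (∑ k, htmul (w k) (EuclideanSpace.single k (1 : ℂ)))) =
      ∑ k, ∑ l, inner ℂ (w k) (A k l (w l)) := by
  have h1 : blockOp A (∑ k, htmul (w k) (EuclideanSpace.single k (1 : ℂ))) =
      ∑ k, ∑ l, htmul (A k l (w l)) (EuclideanSpace.single k (1 : ℂ)) := by
    simp only [blockOp, sum_apply, map_sum, opTensor_htmul, InnerProductSpace.rankOne_apply,
      htmul_smul_right, EuclideanSpace.inner_single_left]
    rw [Finset.sum_comm]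
    simp
  rw [h1, sum_inner]
  refine Finset.sum_congr rfl fun k _ => ?_
  simp only [inner_sum, inner_htmul, EuclideanSpace.inner_single_left]
  simp

/-- The blocks `|xₖ⟩⟨xₗ|` assemble to the rank one projection, up to scale, onto `∑ₖ xₖ ⊗ eₖ`. Its
image is positive and is tested on `∑ₖ wₖ ⊗ eₖ`. -/
theorem IsCompletelyPositive.re_sum_inner_nonneg (hΦ : IsCompletelyPositive Φ) {n : ℕ}
    (x w : Fin n → H) :
    0 ≤ (∑ k, ∑ l, inner ℂ (w k) ((Φ (rankOneTC (x k) (x l)) : H →L[ℂ] H) (w l))).re := by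
  rw [← inner_blockOp (fun k l => (Φ (rankOneTC (x k) (x l)) : H →L[ℂ] H))]
  refine (hΦ n (fun k l => rankOneTC (x k) (x l)) ?_).re_inner_nonneg_right _
  simp only [blockOp, coe_rankOneTC, opTensor_rankOne]
  rw [rankOne_sum_sum]
  exact InnerProductSpace.isPositive_rankOne_self _

variable [CompleteSpace H]

theorem IsCompletelyPositive.isPositive (hΦ : IsCompletelyPositive Φ) {ρ : traceClass H}
    (hρ : (ρ : H →L[ℂ] H).IsPositive) : (Φ ρ : H →L[ℂ] H).IsPositive := by
  let e : EuclideanSpace ℂ (Fin 1) := EuclideanSpace.single 0 1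
  have hblock : ∀ A : Fin 1 → Fin 1 → H →L[ℂ] H,
      blockOp A = htmulRight H e ∘L A 0 0 ∘L ContinuousLinearMap.adjoint (htmulRight H e) :=
    fun A => by
      rw [← opTensor_rankOne_right]
      simp [blockOp, e]
  have h := hΦ 1 (fun _ _ => ρ) (by
    rw [hblock]
    exact hρ.conj_adjoint _)
  rw [hblock] at h
  have h' := h.adjoint_conj (htmulRight H e)
  convert! h' using 1
  ext x
  simp [adjoint_htmulRight_htmul, e]

/-- Each `Φ(|z⟩⟨z|)` is positive, hence self-adjoint, and polarization carries this over to
`|x⟩⟨y|`. -/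
theorem IsCompletelyPositive.adjoint_apply_rankOneTC (hΦ : IsCompletelyPositive Φ) (x y : H) :
    ContinuousLinearMap.adjoint (Φ (rankOneTC x y) : H →L[ℂ] H) = Φ (rankOneTC y x) := by
  have h : ∀ z : H, star (Φ (rankOneTC z z) : H →L[ℂ] H) = Φ (rankOneTC z z) := fun z =>
    (hΦ.isPositive (InnerProductSpace.isPositive_rankOne_self z)).isSelfAdjoint
  have h1 := congrArg (fun ρ => star (Φ ρ : H →L[ℂ] H)) (rankOneTC_polarization x y)
  have h2 := congrArg (fun ρ => (Φ ρ : H →L[ℂ] H)) (rankOneTC_polarization_symm x y)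
  simp only [map_smul, map_add, map_sub, SetLike.val_smul, AddSubgroupClass.coe_sub,
    Submodule.coe_add, star_smul, star_add, star_sub, h] at h1 h2
  have h4 : (4 : ℂ) • star (Φ (rankOneTC x y) : H →L[ℂ] H) =
      (4 : ℂ) • (Φ (rankOneTC y x) : H →L[ℂ] H) := by
    rw [h2]
    have : star (4 : ℂ) = 4 := by simp
    rw [this] at h1
    rw [h1]
    simp
    abel
  exact smul_right_injective _ (by norm_num : (4 : ℂ) ≠ 0) h4

end CompletelyPositive

/-! ### From weak Kraus identities to trace norm convergence -/

section KrausExistence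

variable {H : Type u} [NormedAddCommGroup H] [InnerProductSpace ℂ H]
variable {Φ : traceClass H →ₗ[ℂ] traceClass H}

/-- Deleting finitely many slices subtracts their sums. Applied to the operators and to their norms
alike, it represents the remainder of the Kraus series and bounds its trace norm. -/
theorem hasSum_ite_mem_snd {ι J E : Type*} [NormedAddCommGroup E] [DecidableEq J] {f : ι × J → E}
    {a : E} {b : J → E} (hf : HasSum f a) (hb : ∀ j, HasSum (fun i => f (i, j)) (b j))
    (F : Finset J) : HasSum (fun p => if p.2 ∈ F then 0 else f p) (a - ∑ j ∈ F, b j) := by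
  have h1 : ∀ j ∈ F, HasSum (fun p : ι × J => if p.2 = j then f p else 0) (b j) := fun j _ => by
    have hinj : Function.Injective fun i : ι => (i, j) := fun i i' h => congrArg Prod.fst h
    refine (hinj.hasSum_iff fun p hp => ?_).1 ((hb j).congr_fun fun i => by simp)
    refine if_neg fun hpj => hp ⟨p.1, ?_⟩
    rw [← hpj]
  refine (hf.sub (hasSum_sum h1)).congr_fun fun p => ?_
  by_cases hp : p.2 ∈ F <;> simp [hp]

/-- `Φ(|a⟩⟨b|) = ∑ⱼ |Vⱼ a⟩⟨Vⱼ b|` in the weak operator topology. -/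
def IsWeakKraus {J : Type v} (Φ : traceClass H →ₗ[ℂ] traceClass H) (V : J → H →L[ℂ] H) : Prop :=
  ∀ a b u w : H, HasSum (fun j => inner ℂ u (V j a) * inner ℂ (V j b) w)
    (inner ℂ u ((Φ (rankOneTC a b) : H →L[ℂ] H) w))

theorem hasSum_option_ne_zero {J E F : Type*} [Zero E] [AddCommMonoid F] [TopologicalSpace F]
    {V : J → E} {f : E → F} (hf : f 0 = 0) {a : F} (h : HasSum (fun j => f (V j)) a) :
    HasSum (fun o : Option {j // V j ≠ 0} => f (o.elim 0 fun j => V j)) a := by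
  refine ((Option.some_injective {j // V j ≠ 0}).hasSum_iff fun o ho => ?_).1 ?_
  · cases o with
    | none => exact hf
    | some j => exact absurd ⟨j, rfl⟩ ho
  · refine (hasSum_subtype_iff_of_support_subset (s := {j | V j ≠ 0}) fun j hj hj0 => hj ?_).2 h
    simp only [hj0, hf]

/-- Dropping the zero operators keeps the index set countable when `H` is separable; the added zero
operator at `none` makes it nonempty. -/
theorem IsWeakKraus.option {J : Type v} {V : J → H →L[ℂ] H} (hw : IsWeakKraus Φ V) :
    IsWeakKraus Φ fun o : Option {j // V j ≠ 0} => o.elim 0 fun j => V j := fun a b u w =>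
  hasSum_option_ne_zero (f := fun A : H →L[ℂ] H => inner ℂ u (A a) * inner ℂ (A b) w) (by simp)
    (hw a b u w)

/-- A nonzero `Vⱼ` is nonzero at some point of a countable dense set, and at each point only
countably many `Vⱼ` are nonzero. -/
theorem IsResolution.countable_ne_zero {J : Type v} {V : J → H →L[ℂ] H} (hV : IsResolution V)
    [TopologicalSpace.SeparableSpace H] : Countable {j // V j ≠ 0} := by
  obtain ⟨D, hD, hDd⟩ := TopologicalSpace.exists_countable_dense H
  refine (Set.Countable.mono (fun j hj => ?_)
    (hD.biUnion fun x _ => (hV x).summable.countable_support)).to_subtype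
  by_contra hcon
  refine hj (ContinuousLinearMap.ext fun x => ?_)
  refine congrFun (Continuous.ext_on hDd (V j).continuous continuous_const fun d hd => ?_) x
  by_contra hne
  exact hcon (Set.mem_biUnion hd (by simpa using hne))

variable [CompleteSpace H]

theorem IsCPTP.norm_apply_le_re_opTrace (hΦ : IsCPTP Φ) {ρ : traceClass H}
    (hρ : (ρ : H →L[ℂ] H).IsPositive) : ‖(Φ ρ : H →L[ℂ] H)‖ ≤ (opTrace (ρ : H →L[ℂ] H)).re := by
  rw [← hΦ.2]
  exact (Φ ρ).2.norm_le_re_opTrace (hΦ.1.isPositive hρ)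

/-- Each remainder of the series for `ρ` is positive, so the norm of its image is at most its trace,
which tends to zero. -/
theorem IsCPTP.hasSum_rankOneTC_self (hΦ : IsCPTP Φ) {ι : Type*} {z : ι → H} {ρ : traceClass H}
    (h : HasNuclearSum z z (ρ : H →L[ℂ] H)) :
    HasSum (fun i => (Φ (rankOneTC (z i) (z i)) : H →L[ℂ] H)) (Φ ρ : H →L[ℂ] H) := by
  have htr : HasSum (fun i => ‖z i‖ ^ 2) (opTrace (ρ : H →L[ℂ] H)).re := by
    refine (Complex.hasSum_re h.hasSum_opTrace).congr_fun fun i => ?_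
    rw [inner_self_eq_norm_sq_to_K]
    norm_cast
  rw [HasSum, SummationFilter.unconditional_filter, tendsto_iff_norm_sub_tendsto_zero]
  refine squeeze_zero (fun _ => norm_nonneg _) (fun F => ?_)
    (g := fun F => (opTrace (ρ : H →L[ℂ] H)).re - ∑ i ∈ F, ‖z i‖ ^ 2)
    (by simpa using (tendsto_const_nhds (x := (opTrace (ρ : H →L[ℂ] H)).re)).sub htr)
  have hpos : ((ρ - ∑ i ∈ F, rankOneTC (z i) (z i) : traceClass H) : H →L[ℂ] H).IsPositive := by
    refine ContinuousLinearMap.isPositive_of_hasSum (ι := {i // i ∉ F})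
      (f := fun i => rankOne ℂ (z i) (z i))
      (fun i => InnerProductSpace.isPositive_rankOne_self _) ?_
    rw [Finset.hasSum_compl_iff (f := fun i => rankOne ℂ (z i) (z i))]
    simpa using h.hasSum
  have h1 := hΦ.norm_apply_le_re_opTrace hpos
  rw [map_sub, map_sum, AddSubgroupClass.coe_sub, AddSubgroupClass.coe_sub,
    AddSubmonoidClass.coe_finsetSum, AddSubmonoidClass.coe_finsetSum,
    IsTraceClass.opTrace_sub ρ.2 (IsTraceClass.sum F fun i _ => (rankOneTC (z i) (z i)).2),
    IsTraceClass.opTrace_sum F fun i _ => (rankOneTC (z i) (z i)).2, norm_sub_rev] at h1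
  refine h1.trans_eq ?_
  simp only [coe_rankOneTC, opTrace_rankOne, inner_self_eq_norm_sq_to_K, Complex.sub_re,
    Complex.re_sum]
  norm_cast

theorem IsCPTP.hasSum_rankOneTC (hΦ : IsCPTP Φ) {ι : Type*} {x y : ι → H} {ρ : traceClass H}
    (h : HasNuclearSum x y (ρ : H →L[ℂ] H)) :
    HasSum (fun i => (Φ (rankOneTC (x i) (y i)) : H →L[ℂ] H)) (Φ ρ : H →L[ℂ] H) := by
  choose x' y' hxy hx hy using fun i => exists_balanced (x i) (y i)
  have hcomb : ∀ c : ℂ, ‖c‖ = 1 → ∃ σ : traceClass H,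
      HasSum (fun i => (rankOneTC (x' i + c • y' i) (x' i + c • y' i) : H →L[ℂ] H)) σ ∧
      HasSum (fun i => (Φ (rankOneTC (x' i + c • y' i) (x' i + c • y' i)) : H →L[ℂ] H)) (Φ σ) := by
    intro c hc
    have hs : Summable fun i => ‖x' i + c • y' i‖ * ‖x' i + c • y' i‖ := by
      refine Summable.of_nonneg_of_le (fun i => by positivity) (fun i => ?_)
        -- The constant comes from `(‖x'‖ + ‖y'‖)² ≤ 2 (‖x'‖² + ‖y'‖²) = 4 ‖x‖ ‖y‖`.
        (h.summable.mul_left 4)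
      have h1 := norm_add_le (x' i) (c • y' i)
      rw [norm_smul, hc, one_mul] at h1
      nlinarith [norm_nonneg (x' i + c • y' i), sq_nonneg (‖x' i‖ - ‖y' i‖), hx i, hy i]
    have hn := HasNuclearSum.of_summable hs
    exact ⟨⟨_, hn.isTraceClass⟩, hn.hasSum, hΦ.hasSum_rankOneTC_self (ρ := ⟨_, hn.isTraceClass⟩) hn⟩
  obtain ⟨σ₁, h₁, h₁'⟩ := hcomb 1 (by simp)
  obtain ⟨σ₂, h₂, h₂'⟩ := hcomb (-1) (by simp)
  obtain ⟨σ₃, h₃, h₃'⟩ := hcomb Complex.I (by simp)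
  obtain ⟨σ₄, h₄, h₄'⟩ := hcomb (-Complex.I) (by simp)
  have hpol : ∀ i, (4 : ℂ) • rankOneTC (x i) (y i) =
      rankOneTC (x' i + (1 : ℂ) • y' i) (x' i + (1 : ℂ) • y' i) -
      rankOneTC (x' i + (-1 : ℂ) • y' i) (x' i + (-1 : ℂ) • y' i) +
      Complex.I • rankOneTC (x' i + Complex.I • y' i) (x' i + Complex.I • y' i) -
      Complex.I • rankOneTC (x' i + (-Complex.I) • y' i) (x' i + (-Complex.I) • y' i) := fun i => by
    rw [← hxy i, rankOneTC_polarization]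
    simp only [one_smul, neg_smul, sub_eq_add_neg]
  have hρ : (4 : ℂ) • ρ = σ₁ - σ₂ + Complex.I • σ₃ - Complex.I • σ₄ := by
    refine Subtype.ext ((h.hasSum.const_smul (4 : ℂ)).unique
      ((((h₁.sub h₂).add (h₃.const_smul Complex.I)).sub (h₄.const_smul Complex.I)).congr_fun
        fun i => ?_))
    exact congrArg (Subtype.val) (hpol i)
  have h4 : HasSum (fun i => (4 : ℂ) • (Φ (rankOneTC (x i) (y i)) : H →L[ℂ] H))
      ((4 : ℂ) • (Φ ρ : H →L[ℂ] H)) := by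
    have e1 := congrArg (fun τ => (Φ τ : H →L[ℂ] H)) hρ
    have e2 := fun i => congrArg (fun τ => (Φ τ : H →L[ℂ] H)) (hpol i)
    simp only [map_smul, map_add, map_sub, SetLike.val_smul, AddSubgroupClass.coe_sub,
      Submodule.coe_add] at e1 e2
    rw [e1]
    exact (((h₁'.sub h₂').add (h₃'.const_smul Complex.I)).sub
      (h₄'.const_smul Complex.I)).congr_fun e2
  have h5 := h4.const_smul (4⁻¹ : ℂ)
  simpa [smul_smul] using h5

theorem IsWeakKraus.isKrausFamily {J : Type v} {V : J → H →L[ℂ] H} (hw : IsWeakKraus Φ V)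
    (hΦ : IsCPTP Φ) (hV : IsResolution V) : IsKrausFamily Φ V := by
  classical
  refine ⟨fun ρ => ?_, ContinuousLinearMap.id ℂ H, hV.hasSum_adjoint_apply⟩
  obtain ⟨x, y, r, hxy⟩ := ρ.2
  replace hxy := hxy.hasNuclearSum
  have hs := hV.summable_prod hxy.summable
  have hn := HasNuclearSum.of_summable hs
  have hfib : ∀ n, HasSum (fun j => rankOne ℂ (V j (x n)) (V j (y n)))
      (Φ (rankOneTC (x n) (y n)) : H →L[ℂ] H) := fun n => by
    -- The nuclear series converges in norm, and its sum has the matrix elements prescribed by the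
    -- weak identity.
    have h1 := HasNuclearSum.of_summable (hs.prod_factor n)
    convert! h1.hasSum using 1
    refine ContinuousLinearMap.ext fun w => ext_inner_left ℂ fun u => ?_
    refine (hw (x n) (y n) u w).unique ?_
    have h2 := ((innerSL ℂ u).comp (ContinuousLinearMap.apply ℂ H w)).hasSum h1.hasSum
    refine h2.congr_fun fun j => ?_
    simp [mul_comm]
  have htot : HasSum (fun p : ℕ × J => rankOne ℂ (V p.2 (x p.1)) (V p.2 (y p.1)))
      (Φ ρ : H →L[ℂ] H) := by
    have := hn.hasSum
    rwa [(this.prod_fiberwise hfib).unique (hΦ.hasSum_rankOneTC hxy)] at this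
  have hswap : Summable fun p : J × ℕ => ‖V p.1 (x p.2)‖ * ‖V p.1 (y p.2)‖ :=
    (Equiv.prodComm J ℕ).summable_iff.2 hs
  have hnorm : ∀ j, HasSum (fun n => ‖V j (x n)‖ * ‖V j (y n)‖)
      (∑' n, ‖V j (x n)‖ * ‖V j (y n)‖) := fun j => (hswap.prod_factor j).hasSum
  have hlim := ((Equiv.prodComm J ℕ).hasSum_iff.2 hs.hasSum).prod_fiberwise hnorm
  refine squeeze_zero (fun _ => traceNorm_nonneg _) (fun F => ?_)
    (g := fun F => (∑' p : ℕ × J, ‖V p.2 (x p.1)‖ * ‖V p.2 (y p.1)‖) -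
      ∑ j ∈ F, ∑' n, ‖V j (x n)‖ * ‖V j (y n)‖)
    (by simpa using (tendsto_const_nhds
      (x := ∑' p : ℕ × J, ‖V p.2 (x p.1)‖ * ‖V p.2 (y p.1)‖)).sub hlim)
  have h1 := hasSum_ite_mem_snd hs.hasSum hnorm F
  have h2 := hasSum_ite_mem_snd htot (fun j => (hxy.comp (V j) (V j)).hasSum) F
  rw [← h1.tsum_eq]
  -- The remainder after `F` is the nuclear series over the pairs with `j ∉ F`, so its trace norm is
  -- at most the tail of a convergent scalar series.
  have h3 : HasNuclearSum (fun p : ℕ × J => if p.2 ∈ F then 0 else V p.2 (x p.1))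
      (fun p : ℕ × J => if p.2 ∈ F then 0 else V p.2 (y p.1))
      ((Φ ρ : H →L[ℂ] H) - ∑ j ∈ F, V j ∘L (ρ : H →L[ℂ] H) ∘L
        ContinuousLinearMap.adjoint (V j)) := by
    refine ⟨h1.summable.congr fun p => ?_, h2.congr_fun fun p => ?_⟩ <;>
    · by_cases hp : p.2 ∈ F <;> simp [hp]
  refine h3.traceNorm_le.trans_eq (tsum_congr fun p => ?_)
  by_cases hp : p.2 ∈ F <;> simp [hp]

/-- Compute `tr Φ(|a⟩⟨a|) = ‖a‖²` as a double sum of the nonnegative terms `|⟪eₖ, Vⱼ a⟫|²`; summing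
over `k` first gives `∑ⱼ ‖Vⱼ a‖²`. -/
theorem IsWeakKraus.isResolution {J : Type v} {V : J → H →L[ℂ] H} (hw : IsWeakKraus Φ V)
    (hΦ : IsCPTP Φ) : IsResolution V := by
  intro a
  have h1 : HasSum (fun k => (inner ℂ (onb H k) ((Φ (rankOneTC a a) : H →L[ℂ] H) (onb H k))).re)
      (‖a‖ ^ 2) := by
    have := Complex.hasSum_re (Φ (rankOneTC a a)).2.hasSum_diag
    rw [hΦ.2, coe_rankOneTC, opTrace_rankOne, inner_self_eq_norm_sq_to_K] at this
    convert! this using 1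
    norm_cast
  have h2 : ∀ k, HasSum (fun j => ‖inner ℂ (onb H k) (V j a)‖ ^ 2)
      (inner ℂ (onb H k) ((Φ (rankOneTC a a) : H →L[ℂ] H) (onb H k))).re := fun k => by
    refine (Complex.hasSum_re (hw a a (onb H k) (onb H k))).congr_fun fun j => ?_
    rw [← RCLike.re_to_complex, inner_mul_symm_re_eq_norm, norm_mul, norm_inner_symm (V j a), sq]
  have hs : Summable fun p : onbIndex H × J => ‖inner ℂ (onb H p.1) (V p.2 a)‖ ^ 2 :=
    (summable_prod_of_nonneg fun p => sq_nonneg _).2 ⟨fun k => (h2 k).summable, by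
      simpa only [(h2 _).tsum_eq] using h1.summable⟩
  have h3 := (hs.hasSum.prod_fiberwise h2).unique h1
  have h4 := ((Equiv.prodComm J (onbIndex H)).hasSum_iff.2 hs.hasSum).prod_fiberwise
    fun j => (onb H).hasSum_norm_inner_sq (V j a)
  rwa [h3] at h4

end KrausExistence

/-! ### Kraus operators from the reproducing kernel Hilbert space -/

section KrausExistence

variable {H : Type u} [NormedAddCommGroup H] [InnerProductSpace ℂ H]

theorem rankOneTC_add_right (a b b' : H) :
    rankOneTC a (b + b') = rankOneTC a b + rankOneTC a b' := by
  refine Subtype.ext ?_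
  simp

theorem rankOneTC_smul_right (c : ℂ) (a b : H) :
    rankOneTC a (c • b) = starRingEnd ℂ c • rankOneTC a b := by
  refine Subtype.ext ?_
  simp

variable [CompleteSpace H] {Φ : traceClass H →ₗ[ℂ] traceClass H}

/-- The operator valued kernel `(a, b) ↦ Φ(|a⟩⟨b|)`. -/
def choiKernel (Φ : traceClass H →ₗ[ℂ] traceClass H) : Matrix H H (H →L[ℂ] H) :=
  .of fun a b => (Φ (rankOneTC a b) : H →L[ℂ] H)

theorem IsCompletelyPositive.posSemidef_choiKernel (hΦ : IsCompletelyPositive Φ) :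
    (choiKernel Φ).PosSemidef := by
  have htfae := (RKHS.posSemidef_tfae (K := choiKernel Φ)).out 0 2
  refine htfae.2 ⟨?_, fun v => ?_⟩
  · ext1 a b
    exact hΦ.adjoint_apply_rankOneTC b a
  · let e := v.support.equivFin
    have h := hΦ.re_sum_inner_nonneg (fun k => (e.symm k : H)) (fun k => v (e.symm k))
    have h1 : (∑ k, ∑ l, inner ℂ (v (e.symm k))
        ((Φ (rankOneTC (e.symm k : H) (e.symm l : H)) : H →L[ℂ] H) (v (e.symm l)))) =
        ∑ a ∈ v.support, ∑ b ∈ v.support, inner ℂ (v a)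
          ((Φ (rankOneTC a b) : H →L[ℂ] H) (v b)) := by
      rw [← Finset.sum_coe_sort v.support, ← e.symm.sum_comp]
      refine Finset.sum_congr rfl fun k _ => ?_
      rw [← Finset.sum_coe_sort v.support, ← e.symm.sum_comp]
    rw [h1] at h
    simp only [Finsupp.sum, choiKernel, Matrix.of_apply]
    rw [Finset.sum_comm]
    convert! h using 1
    rw [← RCLike.re_to_complex, map_sum, map_sum]
    refine Finset.sum_congr rfl fun a _ => ?_
    rw [map_sum, map_sum]
    refine Finset.sum_congr rfl fun b _ => ?_
    rw [← inner_conj_symm, RCLike.conj_re]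

/-- The space `M` of the kernel plays the role of the Stinespring space, and an orthonormal basis of
it, read as functions `H → H`, is the Kraus family. -/
theorem IsCPTP.exists_isWeakKraus (hΦ : IsCPTP Φ) :
    ∃ (J : Type u) (V : J → H →L[ℂ] H), IsWeakKraus Φ V := by
  have : Fact (choiKernel Φ).PosSemidef := ⟨hΦ.1.posSemidef_choiKernel⟩
  let M := RKHS.OfKernel (choiKernel Φ)
  have hker : ∀ a b : H, RKHS.kernel M a b = (Φ (rankOneTC a b) : H →L[ℂ] H) := fun a b =>
    congrFun (congrFun RKHS.OfKernel.kernel_ofKernel a) b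
  -- The kernel section at `a` is conjugate linear in `a`, so by the reproducing property every `m`
  -- in `M` is linear in `a`.
  have hadd : ∀ (m : M) (a a' : H), m (a + a') = m a + m a' := fun m a a' => by
    refine ext_inner_left ℂ fun u => ?_
    have : RKHS.kerFun M (a + a') u = RKHS.kerFun M a u + RKHS.kerFun M a' u := by
      refine RKHS.ext fun x => ?_
      rw [RKHS.coe_add, Pi.add_apply, RKHS.kerFun_apply, RKHS.kerFun_apply, RKHS.kerFun_apply,
        hker, hker, hker, rankOneTC_add_right, map_add, Submodule.coe_add, add_apply]
    rw [← RKHS.kerFun_inner, this, inner_add_left, RKHS.kerFun_inner, RKHS.kerFun_inner,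
      inner_add_right]
  have hsmul : ∀ (m : M) (c : ℂ) (a : H), m (c • a) = c • m a := fun m c a => by
    refine ext_inner_left ℂ fun u => ?_
    have : RKHS.kerFun M (c • a) u = starRingEnd ℂ c • RKHS.kerFun M a u := by
      refine RKHS.ext fun x => ?_
      rw [RKHS.coe_smul, Pi.smul_apply, RKHS.kerFun_apply, RKHS.kerFun_apply,
        hker, hker, rankOneTC_smul_right, map_smul, SetLike.val_smul, smul_apply]
    rw [← RKHS.kerFun_inner, this, inner_smul_left, RKHS.kerFun_inner, inner_smul_right,
      RCLike.conj_conj]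
  -- Evaluation at `a` has norm at most `√‖Φ(|a⟩⟨a|)‖ ≤ √(tr |a⟩⟨a|) = ‖a‖`.
  have hbound : ∀ (m : M) (a : H), ‖m a‖ ≤ ‖m‖ * ‖a‖ := fun m a => by
    refine (RKHS.norm_apply_le m a).trans ?_
    gcongr
    rw [hker]
    refine Real.sqrt_le_left (norm_nonneg a) |>.2 ?_
    have h := hΦ.norm_apply_le_re_opTrace (ρ := rankOneTC a a)
      (InnerProductSpace.isPositive_rankOne_self a)
    rw [coe_rankOneTC, opTrace_rankOne, inner_self_eq_norm_sq_to_K] at h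
    convert! h using 1
    norm_cast
  let V : M → H →L[ℂ] H := fun m => LinearMap.mkContinuous
    { toFun := m, map_add' := hadd m, map_smul' := hsmul m } ‖m‖ (hbound m)
  obtain ⟨s, β, hβ⟩ := exists_hilbertBasis ℂ M
  refine ⟨s, fun j => V j, fun a b u w => ?_⟩
  -- Parseval in `M`: the inner product of two kernel sections is a matrix element of `Φ(|a⟩⟨b|)`,
  -- and their coefficients are `⟪u, Vⱼ a⟫` and `⟪Vⱼ b, w⟫`.
  have h := β.hasSum_inner_mul_inner (RKHS.kerFun M a u) (RKHS.kerFun M b w)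
  rw [← RKHS.kernel_inner, hker, ← hΦ.1.adjoint_apply_rankOneTC,
    ContinuousLinearMap.adjoint_inner_left] at h
  refine h.congr_fun fun j => ?_
  rw [hβ, RKHS.kerFun_inner, RKHS.inner_kerFun]
  rfl

end KrausExistence

/-! ### Separability of the auxiliary space -/

section Separable

theorem separableSpace_ell2 (J : Type v) [Countable J] :
    TopologicalSpace.SeparableSpace (ell2 J) := by
  let b : HilbertBasis J ℂ (ell2 J) := HilbertBasis.ofRepr (LinearIsometryEquiv.refl ℂ (ell2 J))
  have h1 : TopologicalSpace.IsSeparable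
      ((Submodule.span ℂ (Set.range b)).topologicalClosure : Set (ell2 J)) :=
    (Set.countable_range b).isSeparable.span.closure
  rw [b.dense_span] at h1
  exact TopologicalSpace.isSeparable_univ_iff.1 (by simpa using h1)

theorem separableSpace_hTensor (H : Type u) [NormedAddCommGroup H] [InnerProductSpace ℂ H]
    (K : Type v) [NormedAddCommGroup K] [InnerProductSpace ℂ K]
    [TopologicalSpace.SeparableSpace H] [TopologicalSpace.SeparableSpace K] :
    TopologicalSpace.SeparableSpace (HTensor H K) := by
  let s : Set (HTensor H K) := Set.range fun p : H × K => htmul p.1 p.2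
  have hcont : Continuous fun p : H × K => (htmul p.1 p.2 : HTensor H K) :=
    (UniformSpace.Completion.continuous_coe _).comp TensorProduct.continuous_tmul
  have hs : TopologicalSpace.IsSeparable s := TopologicalSpace.isSeparable_range hcont
  have hd : DenseRange (Submodule.span ℂ s).subtype := denseRange_of_htmul _ fun x y =>
    subset_closure ⟨⟨htmul x y, Submodule.subset_span ⟨(x, y), rfl⟩⟩, rfl⟩
  have h1 : TopologicalSpace.IsSeparable (closure (Submodule.span ℂ s : Set (HTensor H K))) :=
    hs.span.closure
  have h2 : closure (Submodule.span ℂ s : Set (HTensor H K)) = Set.univ := by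
    have := hd.closure_range
    simpa using this
  rw [h2] at h1
  exact TopologicalSpace.isSeparable_univ_iff.1 h1

end Separable

end

/-! ### The dilation theorem -/

theorem theorem1 {H : Type u} [NormedAddCommGroup H] [InnerProductSpace ℂ H] [CompleteSpace H]
    (Φ : traceClass H →ₗ[ℂ] traceClass H) (hΦ : IsCPTP Φ) :
    -- existence of a Stinespring form
    (∃ (K : Type u) (_ : NormedAddCommGroup K) (_ : InnerProductSpace ℂ K) (_ : CompleteSpace K)
      (ψ : K) (U : HTensor H K →L[ℂ] HTensor H K), IsStinespringForm Φ ψ U) ∧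
    -- (i) and (ii): any Kraus family, any index, and a unitary for which the qubit is a catalyst
    (∀ (J : Type v) (V : J → H →L[ℂ] H), IsKrausFamily Φ V → ∀ j₀ : J,
      ∃ U : HTensor H (HTensor (ell2 J) Qubit) →L[ℂ] HTensor H (HTensor (ell2 J) Qubit),
        IsStinespringForm Φ (htmul (ell2Basis j₀) qubitOne) U ∧ IsQubitCatalyst j₀ U) ∧
    -- (i), separable case
    (TopologicalSpace.SeparableSpace H →
      ∃ (J : Type u) (V : J → H →L[ℂ] H) (j₀ : J)
        (U : HTensor H (HTensor (ell2 J) Qubit) →L[ℂ] HTensor H (HTensor (ell2 J) Qubit)),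
        IsKrausFamily Φ V ∧ TopologicalSpace.SeparableSpace (HTensor (ell2 J) Qubit) ∧
        IsStinespringForm Φ (htmul (ell2Basis j₀) qubitOne) U ∧ IsQubitCatalyst j₀ U) := by
  obtain ⟨J, V, hV⟩ := hΦ.exists_isWeakKraus
  have hV' := hV.option.isKrausFamily hΦ (hV.option.isResolution hΦ)
  -- The index `none` exists whatever the family is, so it serves as `j₀` both for bare existence
  -- and in the separable case.
  obtain ⟨U, hU, hcat⟩ := hV'.exists_stinespring hΦ none
  refine ⟨⟨HTensor (ell2 (Option {j // V j ≠ 0})) Qubit, inferInstance, inferInstance,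
    inferInstance, _, U, hU⟩, fun J V hV j₀ => hV.exists_stinespring hΦ j₀, fun hsep => ?_⟩
  have := (hV.isResolution hΦ).countable_ne_zero
  have := separableSpace_ell2 (Option {j // V j ≠ 0})
  exact ⟨_, _, none, U, hV', separableSpace_hTensor _ _, hU, hcat⟩
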